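/- Let $\mathbb G=(V,E)$ be a contextuality scenario: $V$ is a finite set and $E$ is a non-empty set of subsets of $V$ (the hyperedges) with $\bigcup_{e\in E}e=V$. A probabilistic model of $\mathbb G$ is a function $p:V\to[0,1]$ with $\sum_{x\in e}p(x)=1$ for all $e\in E$; let $\mathcal G(\mathbb G)$ be the set of all probabilistic models, and assume that $\mathcal G(\mathbb G)\neq\emptyset$ (that is, $\mathbb G$ is non-trivial). Let $\mathcal C(\mathbb G)$ be the set of classical models, i.e. convex combinations of $\{0,1\}$-valued probabilistic models, and let $\mathcal Q(\mathbb G)$ be the set of quantum models, i.e. functions $p(x)=\langle P_x\psi,\psi\rangle$, where $\psi$ is a unit vector in a Hilbert space $H$ and $(P_x)_{x\in V}$ are orthogonal projections on $H$ with $\sum_{x\in e}P_x=I$ for all $e\in E$. Define three operator systems with generators indexed by $V$. * Let $\mathcal S=\bigoplus_{e\in E}\ell^\infty_e$, let $\langle p,u\rangle=\sum_{e\in E}\sum_{x\in e}p(x)u^e_x$ for $u\in\mathcal S$, and let $\tilde{\mathcal J}=\{u\in\mathcal S:\langle p,u\rangle=0\text{ for all }p\in\mathcal G(\mathbb G)\}$.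 Then $\mathcal S_{\mathbb G}=\mathcal S/\tilde{\mathcal J}$ is the operator system quotient (an element of $M_n(\mathcal S/\tilde{\mathcal J})$ is positive iff, for every $r>0$, its sum with $r1$ has a positive lift in $M_n(\mathcal S)$), with generators $a_x=|E|\,(\delta^e_x+\tilde{\mathcal J})$ for any $e\ni x$. * Let $C^*(\mathbb G)$ be the universal unital C*-algebra generated by projections $p_x$, $x\in V$, with $\sum_{x\in e}p_x=1$ for all $e\in E$. Then $\mathcal T_{\mathbb G}=\mathrm{span}\{p_x:x\in V\}$, as an operator subsystem of $C^*(\mathbb G)$. * Let $\mathcal D_{\mathbb G}$ be the quotient of the abelian C*-algebra $\bigotimes_{e\in E}\ell^\infty_e$ by the ideal generated by the differences of the canonical images of $\delta^e_x$ and $\delta^f_x$, for $e,f\in E$, $x\in e\cap f$, and let $d_x$ be the image of $\delta^e_x$ (for any $e\ni x$) in $\mathcal D_{\mathbb G}$. Then $\mathcal R_{\mathbb G}=\mathrm{span}\{d_x:x\in V\}$, as an operator subsystem of $\mathcal D_{\mathbb G}$. For an operator system (or Archimedean order unit space) $W$, let $\mathrm{OMIN}(W)$ be the minimal operator system structure on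 $W$: a matrix $(w_{ij})\in M_n(W)$ is positive iff $\sum_{i,j}\overline{\lambda_i}\lambda_j w_{ij}\in W^+$ for all $\lambda\in\mathbb C^n$. The zero space is admitted as an operator system. Equality of two of these operator systems means that there is a unital complete order isomorphism between them that maps, for every $x\in V$, the generator with index $x$ to the generator with index $x$. Then: 1. $\mathcal G(\mathbb G)=\mathcal Q(\mathbb G)$ if and only if $\mathrm{OMIN}(\mathcal S_{\mathbb G})=\mathrm{OMIN}(\mathcal T_{\mathbb G})$; 2. $\mathcal Q(\mathbb G)=\mathcal C(\mathbb G)$ if and only if $\mathrm{OMIN}(\mathcal T_{\mathbb G})=\mathcal R_{\mathbb G}$; 3. $\mathcal C(\mathbb G)=\mathcal G(\mathbb G)$ if and only if $\mathcal R_{\mathbb G}=\mathrm{OMIN}(\mathcal S_{\mathbb G})$. -/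

import Mathlib

universe u

open scoped ComplexOrder

/-! ### Abstract operator systems -/

namespace OperatorSystem

section MatrixAux

variable {S T : Type*} [AddCommGroup S] [Module ℂ S] [AddCommGroup T] [Module ℂ T]

/-- `T* a T` for a matrix `a` over a complex vector space and a scalar matrix `T`. -/
def compress {n m : ℕ} (T : Matrix (Fin n) (Fin m) ℂ) (a : Matrix (Fin n) (Fin n) S) :
    Matrix (Fin m) (Fin m) S :=
  Matrix.of fun i j => ∑ k, ∑ l, (star (T k i) * T l j) • a k l

/-- `λ* a λ` for a matrix `a` over a complex vector space and a column `λ`. -/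
def quad {n : ℕ} (a : Matrix (Fin n) (Fin n) S) (l : Fin n → ℂ) : S :=
  ∑ i, ∑ j, (star (l i) * l j) • a i j

/-- The diagonal matrix with all diagonal entries equal to `s`. -/
def diag (n : ℕ) (s : S) : Matrix (Fin n) (Fin n) S := Matrix.diagonal fun _ => s

/-- The one by one matrix with entry `s`. -/
def single (s : S) : Matrix (Fin 1) (Fin 1) S := Matrix.of fun _ _ => s

theorem compress_add {n m : ℕ} (t : Matrix (Fin n) (Fin m) ℂ) (a b : Matrix (Fin n) (Fin n) S) :
    compress t (a + b) = compress t a + compress t b := by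
  ext i j
  simp [compress, smul_add, Finset.sum_add_distrib]

theorem compress_smul {n m : ℕ} (t : Matrix (Fin n) (Fin m) ℂ) (z : ℂ)
    (a : Matrix (Fin n) (Fin n) S) : compress t (z • a) = z • compress t a := by
  ext i j
  simp [compress, Finset.smul_sum, smul_comm z]

theorem compress_neg {n m : ℕ} (t : Matrix (Fin n) (Fin m) ℂ)
    (a : Matrix (Fin n) (Fin n) S) : compress t (-a) = -compress t a := by
  ext i j
  simp [compress]

theorem compress_map {n m : ℕ} (t : Matrix (Fin n) (Fin m) ℂ) (f : S →ₗ[ℂ] T)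
    (a : Matrix (Fin n) (Fin n) S) : (compress t a).map f = compress t (a.map f) := by
  ext i j
  simp [compress]

theorem compress_col {n : ℕ} (l : Fin n → ℂ) (a : Matrix (Fin n) (Fin n) S) :
    compress (Matrix.of fun i (_ : Fin 1) => l i) a = single (quad a l) := by
  ext i j
  simp [compress, single, quad]

theorem compress_diag {n m : ℕ} (t : Matrix (Fin n) (Fin m) ℂ) (s : S) (i j : Fin m) :
    compress t (diag n s) i j = (∑ k, star (t k i) * t k j) • s := by
  simp [compress, diag, Matrix.diagonal_apply, Finset.sum_smul]

theorem quad_add {n : ℕ} (a b : Matrix (Fin n) (Fin n) S) (l : Fin n → ℂ) :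
    quad (a + b) l = quad a l + quad b l := by
  simp [quad, smul_add, Finset.sum_add_distrib]

theorem quad_smul {n : ℕ} (z : ℂ) (a : Matrix (Fin n) (Fin n) S) (l : Fin n → ℂ) :
    quad (z • a) l = z • quad a l := by
  simp [quad, Finset.smul_sum, smul_comm z]

theorem quad_neg {n : ℕ} (a : Matrix (Fin n) (Fin n) S) (l : Fin n → ℂ) :
    quad (-a) l = -quad a l := by
  simp [quad]

theorem quad_map {n : ℕ} (f : S →ₗ[ℂ] T) (a : Matrix (Fin n) (Fin n) S) (l : Fin n → ℂ) :
    quad (a.map f) l = f (quad a l) := by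
  simp [quad]

theorem quad_diag {n : ℕ} (s : S) (l : Fin n → ℂ) :
    quad (diag n s) l = ((∑ i, ‖l i‖ ^ 2 : ℝ) : ℂ) • s := by
  simp only [quad, diag, Matrix.diagonal_apply, smul_ite, smul_zero, Finset.sum_ite_eq,
    Finset.mem_univ, if_true, ← Finset.sum_smul]
  congr 1
  push_cast
  exact Finset.sum_congr rfl fun i _ => Complex.conj_mul' (l i)

theorem quad_compress {n m : ℕ} (t : Matrix (Fin n) (Fin m) ℂ) (a : Matrix (Fin n) (Fin n) S)
    (l : Fin m → ℂ) : quad (compress t a) l = quad a (t.mulVec l) := by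
  simp only [quad, compress, Matrix.of_apply, Finset.smul_sum, smul_smul, Matrix.mulVec,
    dotProduct, star_sum, Finset.sum_mul_sum, Finset.sum_smul, star_mul']
  calc _ = ∑ i, ∑ k, ∑ j, ∑ q, (star (l i) * l j * (star (t k i) * t q j)) • a k q :=
        Finset.sum_congr rfl fun i _ => Finset.sum_comm
    _ = ∑ k, ∑ i, ∑ j, ∑ q, (star (l i) * l j * (star (t k i) * t q j)) • a k q :=
        Finset.sum_comm
    _ = ∑ k, ∑ i, ∑ q, ∑ j, (star (l i) * l j * (star (t k i) * t q j)) • a k q :=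
        Finset.sum_congr rfl fun k _ => Finset.sum_congr rfl fun i _ => Finset.sum_comm
    _ = ∑ k, ∑ q, ∑ i, ∑ j, (star (l i) * l j * (star (t k i) * t q j)) • a k q :=
        Finset.sum_congr rfl fun k _ => Finset.sum_comm
    _ = _ := by
        refine Finset.sum_congr rfl fun k _ => Finset.sum_congr rfl fun q _ =>
          Finset.sum_congr rfl fun i _ => Finset.sum_congr rfl fun j _ => ?_
        congr 1
        ring

theorem quad_polar {n : ℕ} {a : Matrix (Fin n) (Fin n) S} (h : ∀ l, quad a l = 0) : a = 0 := by
  have key : ∀ (i j : Fin n) (c : ℂ),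
      quad a (Pi.single i 1 + Pi.single j c) =
        a i i + c • a i j + star c • a j i + (star c * c) • a j j := by
    intro i j c
    simp only [quad, Pi.add_apply, star_add, add_mul, mul_add, add_smul, Finset.sum_add_distrib,
      Pi.single_apply, apply_ite star, star_zero, star_one, ite_mul, mul_ite, zero_mul, mul_zero,
      one_mul, mul_one, ite_smul, zero_smul, one_smul, Finset.sum_ite_eq', Finset.mem_univ, if_true]
    simp
    abel
  have diag0 : ∀ i, a i i = 0 := fun i => by
    have := key i i 0
    rw [h] at this
    simpa using this.symm
  ext i j
  have h1 := key i j 1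
  have h2 := key i j Complex.I
  rw [h, diag0, diag0] at h1 h2
  simp only [star_one, one_smul, smul_zero, add_zero, zero_add] at h1
  have e1 : a j i = -a i j := by rw [eq_neg_iff_add_eq_zero, add_comm]; exact h1.symm
  rw [e1] at h2
  have h3 : (2 * Complex.I) • a i j = 0 := by
    rw [h2]; simp [two_mul, add_smul]
  simpa using h3

theorem star_quad [StarAddMonoid S] [StarModule ℂ S] {n : ℕ} (a : Matrix (Fin n) (Fin n) S)
    (l : Fin n → ℂ) : star (quad a l) = quad a.conjTranspose l := by
  simp only [quad, star_sum, star_smul, star_mul', star_star, Matrix.conjTranspose_apply]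
  rw [Finset.sum_comm]
  simp only [mul_comm]

theorem diag_conjTranspose [StarAddMonoid S] (n : ℕ) {s : S} (hs : star s = s) :
    (diag n s).conjTranspose = diag n s := by
  simp [diag, Matrix.diagonal_conjTranspose, Pi.star_def, hs]

theorem compress_conjTranspose [StarAddMonoid S] [StarModule ℂ S] {n m : ℕ}
    (t : Matrix (Fin n) (Fin m) ℂ) (a : Matrix (Fin n) (Fin n) S) :
    (compress t a).conjTranspose = compress t a.conjTranspose := by
  ext i j
  simp only [compress, Matrix.conjTranspose_apply, Matrix.of_apply, star_sum, star_smul, star_mul',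
    star_star]
  rw [Finset.sum_comm]
  simp only [mul_comm]

end MatrixAux

end OperatorSystem

section Structures

open OperatorSystem

/-- An Archimedean order unit space structure on a complex *-vector space: a proper cone of
self-adjoint elements with an Archimedean order unit. -/
structure AOUSpace (S : Type*) [AddCommGroup S] [Module ℂ S] [StarAddMonoid S]
    [StarModule ℂ S] where
  cone : Set S
  unit : S
  star_unit : star unit = unit
  star_eq : ∀ s ∈ cone, star s = s
  zero_mem : (0 : S) ∈ cone
  add_mem : ∀ s ∈ cone, ∀ t ∈ cone, s + t ∈ cone
  smul_mem : ∀ r : ℝ, 0 ≤ r → ∀ s ∈ cone, (r : ℂ) • s ∈ cone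
  proper : ∀ s ∈ cone, -s ∈ cone → s = 0
  orderUnit : ∀ s, star s = s → ∃ r : ℝ, 0 < r ∧ (r : ℂ) • unit + s ∈ cone
  archimedean : ∀ s, star s = s → (∀ r : ℝ, 0 < r → (r : ℂ) • unit + s ∈ cone) → s ∈ cone

/-- An (abstract) operator system structure on a complex *-vector space `S`: a matrix ordering
`(M_n(S)^+)_n` by proper cones, with an Archimedean matrix order unit. -/
structure OperatorSystem (S : Type*) [AddCommGroup S] [Module ℂ S] [StarAddMonoid S]
    [StarModule ℂ S] where
  pos : ∀ n : ℕ, Set (Matrix (Fin n) (Fin n) S)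
  unit : S
  star_unit : star unit = unit
  conjTranspose_eq : ∀ n, ∀ a ∈ pos n, a.conjTranspose = a
  zero_mem : ∀ n, (0 : Matrix (Fin n) (Fin n) S) ∈ pos n
  add_mem : ∀ n, ∀ a ∈ pos n, ∀ b ∈ pos n, a + b ∈ pos n
  smul_mem : ∀ n, ∀ r : ℝ, 0 ≤ r → ∀ a ∈ pos n, (r : ℂ) • a ∈ pos n
  proper : ∀ n, ∀ a ∈ pos n, -a ∈ pos n → a = 0
  compress_mem : ∀ n m, ∀ t : Matrix (Fin n) (Fin m) ℂ, ∀ a ∈ pos n, compress t a ∈ pos m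
  orderUnit : ∀ n, ∀ a : Matrix (Fin n) (Fin n) S, a.conjTranspose = a →
    ∃ r : ℝ, 0 < r ∧ (r : ℂ) • diag n unit + a ∈ pos n
  archimedean : ∀ n, ∀ a : Matrix (Fin n) (Fin n) S, a.conjTranspose = a →
    (∀ r : ℝ, 0 < r → (r : ℂ) • diag n unit + a ∈ pos n) → a ∈ pos n

namespace AOUSpace

variable {S : Type*} [AddCommGroup S] [Module ℂ S] [StarAddMonoid S] [StarModule ℂ S]
  (X : AOUSpace S)

theorem smul_unit_mem {r : ℝ} (hr : 0 ≤ r) : (r : ℂ) • X.unit ∈ X.cone := by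
  obtain ⟨c, hc, h⟩ := X.orderUnit 0 (star_zero S)
  have := X.smul_mem (r / c) (by positivity) _ h
  rwa [add_zero, smul_smul, ← Complex.ofReal_mul, div_mul_cancel₀ _ hc.ne'] at this

theorem sum_mem {ι : Type*} (t : Finset ι) (f : ι → S) (h : ∀ i ∈ t, f i ∈ X.cone) :
    ∑ i ∈ t, f i ∈ X.cone :=
  Finset.sum_induction f (· ∈ X.cone) (fun a b ha hb => X.add_mem a ha b hb) X.zero_mem h

theorem mono {r r' : ℝ} (h : r ≤ r') {s : S} (hs : (r : ℂ) • X.unit + s ∈ X.cone) :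
    (r' : ℂ) • X.unit + s ∈ X.cone := by
  have := X.add_mem _ (X.smul_unit_mem (sub_nonneg.2 h)) _ hs
  rwa [← add_assoc, ← add_smul, ← Complex.ofReal_add, sub_add_cancel] at this

theorem exists_bound_real {s : S} (hs : star s = s) :
    ∃ r : ℝ, 0 ≤ r ∧ ∀ t : ℝ, ((r * |t| : ℝ) : ℂ) • X.unit + (t : ℂ) • s ∈ X.cone := by
  obtain ⟨a, ha, h⟩ := X.orderUnit s hs
  obtain ⟨b, hb, h'⟩ := X.orderUnit (-s) (by rw [star_neg, hs])
  refine ⟨max a b, le_max_of_le_left ha.le, fun t => ?_⟩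
  rcases le_total 0 t with ht | ht
  · have := X.smul_mem t ht _ (X.mono (le_max_left a b) h)
    rw [smul_add, smul_smul, ← Complex.ofReal_mul, mul_comm] at this
    rwa [abs_of_nonneg ht]
  · have := X.smul_mem (-t) (neg_nonneg.2 ht) _ (X.mono (le_max_right a b) h')
    rw [smul_add, smul_smul, ← Complex.ofReal_mul, mul_comm (-t), smul_neg, ← neg_smul,
      ← Complex.ofReal_neg, neg_neg] at this
    rwa [abs_of_nonpos ht]

theorem exists_bound (s : S) :
    ∃ r : ℝ, 0 ≤ r ∧ ∀ z : ℂ, ((r * ‖z‖ : ℝ) : ℂ) • X.unit + (z • s + star (z • s)) ∈ X.cone := by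
  obtain ⟨a, ha, h⟩ := X.exists_bound_real (s := s + star s) (by
    rw [star_add, star_star, add_comm])
  obtain ⟨b, hb, h'⟩ := X.exists_bound_real (s := Complex.I • (s - star s)) (by
    rw [star_smul, star_sub, star_star, Complex.star_def, Complex.conj_I, neg_smul, ← smul_neg,
      neg_sub])
  refine ⟨a + b, add_nonneg ha hb, fun z => ?_⟩
  have h1 := X.mono (mul_le_mul_of_nonneg_left (Complex.abs_re_le_norm z) ha) (h z.re)
  have h2 := X.mono (mul_le_mul_of_nonneg_left (Complex.abs_im_le_norm z) hb) (h' z.im)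
  have h3 := X.add_mem _ h1 _ h2
  convert h3 using 1
  have hz : z = z.re + z.im * Complex.I := (Complex.re_add_im z).symm
  have hz' : star z = z.re - z.im * Complex.I := by
    rw [Complex.star_def]
    apply Complex.ext <;> simp
  rw [star_smul, hz', show z • s = ((z.re : ℂ) + z.im * Complex.I) • s by rw [← hz]]
  push_cast
  module

theorem orderUnit_quad {n : ℕ} (a : Matrix (Fin n) (Fin n) S) (ha : a.conjTranspose = a) :
    ∃ r : ℝ, 0 < r ∧ ∀ l, quad ((r : ℂ) • diag n X.unit + a) l ∈ X.cone := by
  choose r hr h using fun i j => X.exists_bound (a i j)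
  have hR : 0 ≤ ∑ i, ∑ j, r i j := Finset.sum_nonneg fun i _ => Finset.sum_nonneg fun j _ => hr i j
  refine ⟨(∑ i, ∑ j, r i j) / 2 + 1, by positivity, fun l => ?_⟩
  set L : ℝ := ∑ i, ‖l i‖ ^ 2 with hL
  have hL0 : 0 ≤ L := Finset.sum_nonneg fun i _ => by positivity
  have hle : ∀ i j, ‖star (l i) * l j‖ ≤ L := fun i j => by
    have h1 : ‖l i‖ ^ 2 ≤ L :=
      Finset.single_le_sum (f := fun i => ‖l i‖ ^ 2) (fun i _ => by positivity) (Finset.mem_univ i)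
    have h2 : ‖l j‖ ^ 2 ≤ L :=
      Finset.single_le_sum (f := fun i => ‖l i‖ ^ 2) (fun i _ => by positivity) (Finset.mem_univ j)
    rw [norm_mul, norm_star]
    nlinarith [sq_nonneg (‖l i‖ - ‖l j‖)]
  have key := X.sum_mem Finset.univ _ fun i _ => X.sum_mem Finset.univ _ fun j _ =>
    X.mono (mul_le_mul_of_nonneg_left (hle i j) (hr i j)) (h i j (star (l i) * l j))
  simp only [Finset.sum_add_distrib, ← star_sum, ← Finset.sum_smul] at key
  change _ + (quad a l + star (quad a l)) ∈ _ at key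
  rw [star_quad, ha] at key
  have key2 := X.smul_mem (1 / 2) (by norm_num) _ key
  rw [quad_add, quad_smul, quad_diag, smul_smul, ← Complex.ofReal_mul]
  refine X.mono (r := (∑ i, ∑ j, r i j) / 2 * L) (by nlinarith) ?_
  convert key2 using 1
  have e : (∑ i, ∑ j, ((r i j * L : ℝ) : ℂ)) = ((∑ i, ∑ j, (r i j : ℂ)) * L) := by
    push_cast
    simp only [Finset.sum_mul]
  rw [e]
  push_cast
  module

/-- The minimal operator system structure `OMIN(V)` on an Archimedean order unit space `V`:
`a ∈ M_n(V)^+` if and only if `λ* a λ ∈ V^+` for all columns `λ ∈ ℂ^n`. -/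
def OMIN : OperatorSystem S where
  pos n := {a | ∀ l : Fin n → ℂ, quad a l ∈ X.cone}
  unit := X.unit
  star_unit := X.star_unit
  conjTranspose_eq n a ha := by
    rw [← sub_eq_zero]
    refine quad_polar fun l => ?_
    rw [sub_eq_add_neg, quad_add, quad_neg, ← star_quad, X.star_eq _ (ha l), add_neg_cancel]
  zero_mem n l := by
    have : quad (0 : Matrix (Fin n) (Fin n) S) l = 0 := by simp [quad]
    rw [this]
    exact X.zero_mem
  add_mem n a ha b hb l := by
    rw [quad_add]
    exact X.add_mem _ (ha l) _ (hb l)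
  smul_mem n r hr a ha l := by
    rw [quad_smul]
    exact X.smul_mem r hr _ (ha l)
  proper n a ha hb := quad_polar fun l => X.proper _ (ha l) (by
    rw [← quad_neg]
    exact hb l)
  compress_mem n m t a ha l := by
    rw [quad_compress]
    exact ha _
  orderUnit n a ha := X.orderUnit_quad a ha
  archimedean n a ha h l := by
    have hs : star (quad a l) = quad a l := by rw [star_quad, ha]
    refine X.archimedean _ hs fun r hr => ?_
    set L : ℝ := ∑ i, ‖l i‖ ^ 2
    have hL0 : 0 ≤ L := Finset.sum_nonneg fun i _ => by positivity
    have := h (r / (L + 1)) (by positivity) l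
    rw [quad_add, quad_smul, quad_diag, smul_smul, ← Complex.ofReal_mul] at this
    refine X.mono ?_ this
    rw [div_mul_eq_mul_div, div_le_iff₀ (by positivity)]
    nlinarith

end AOUSpace

end Structures

namespace OperatorSystem

variable {S T : Type*} [AddCommGroup S] [Module ℂ S] [StarAddMonoid S] [StarModule ℂ S]
  [AddCommGroup T] [Module ℂ T] [StarAddMonoid T] [StarModule ℂ T]

section Basic

variable (X : OperatorSystem S)

theorem single_star_iff (s : S) : (single s).conjTranspose = single s ↔ star s = s := by
  constructor
  · intro h
    have := congrFun (congrFun h 0) 0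
    simpa [single] using this
  · intro h
    ext i j
    simpa [single] using h

theorem single_diag (s : S) : diag 1 s = single s := by
  ext i j
  simp [diag, single, Subsingleton.elim i j]

/-- The Archimedean order unit space underlying an operator system. -/
def toAOUSpace : AOUSpace S where
  cone := {s | single s ∈ X.pos 1}
  unit := X.unit
  star_unit := X.star_unit
  star_eq s hs := (single_star_iff s).1 (X.conjTranspose_eq 1 _ hs)
  zero_mem := X.zero_mem 1
  add_mem s hs t ht := X.add_mem 1 _ hs _ ht
  smul_mem r hr s hs := X.smul_mem 1 r hr _ hs
  proper s hs ht := by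
    have := X.proper 1 _ hs ht
    exact congrFun (congrFun this 0) 0
  orderUnit s hs := by
    obtain ⟨r, hr, h⟩ := X.orderUnit 1 (single s) ((single_star_iff s).2 hs)
    rw [single_diag] at h
    exact ⟨r, hr, h⟩
  archimedean s hs h := by
    refine X.archimedean 1 (single s) ((single_star_iff s).2 hs) fun r hr => ?_
    rw [single_diag]
    exact h r hr

/-- `OMIN` of (the order unit space underlying) an operator system. -/
def OMIN : OperatorSystem S := X.toAOUSpace.OMIN

/-- States: unital positive linear functionals. -/
def IsState (f : S →ₗ[ℂ] ℂ) : Prop := f X.unit = 1 ∧ ∀ s ∈ X.toAOUSpace.cone, 0 ≤ f s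

theorem smul_diag_mem (n : ℕ) {r : ℝ} (hr : 0 ≤ r) : (r : ℂ) • diag n X.unit ∈ X.pos n := by
  obtain ⟨c, hc, h⟩ := X.orderUnit n 0 (Matrix.conjTranspose_zero)
  have := X.smul_mem n (r / c) (by positivity) _ h
  rwa [add_zero, smul_smul, ← Complex.ofReal_mul, div_mul_cancel₀ _ hc.ne'] at this

end Basic

section Maps

variable (X : OperatorSystem S) (Y : OperatorSystem T)

/-- Completely positive linear maps. -/
def IsCompletelyPositive (φ : S →ₗ[ℂ] T) : Prop :=
  ∀ n, ∀ a ∈ X.pos n, a.map φ ∈ Y.pos n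

/-- Unital complete order isomorphisms. -/
def IsUnitalCompleteOrderIso (φ : S ≃ₗ[ℂ] T) : Prop :=
  φ X.unit = Y.unit ∧ IsCompletelyPositive X Y φ.toLinearMap ∧
    IsCompletelyPositive Y X φ.symm.toLinearMap

/-- Every positive map into the order unit space of `Y` is completely positive into `Y.OMIN`. -/
theorem isCompletelyPositive_OMIN (φ : S →ₗ[ℂ] T)
    (h : ∀ s ∈ X.toAOUSpace.cone, φ s ∈ Y.toAOUSpace.cone) :
    IsCompletelyPositive X Y.OMIN φ := fun n a ha l => by
  rw [quad_map]
  have h1 := X.compress_mem n 1 (Matrix.of fun i (_ : Fin 1) => l i) a ha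
  rw [compress_col] at h1
  exact h _ h1

/-- Equality of two operator systems with generators `a` and `b` indexed by the same set, up to
the canonical unital complete order isomorphism: the one that sends `a x` to `b x` for all `x`. -/
def CanonicallyEq {V : Type*} (a : V → S) (b : V → T) : Prop :=
  ∃ φ : S ≃ₗ[ℂ] T, (∀ x, φ (a x) = b x) ∧ IsUnitalCompleteOrderIso X Y φ

end Maps

section Subsystem

/-- The linear span of a family of self-adjoint elements, a *-vector space. -/
@[nolint unusedArguments]
def SelfAdjSpan {V : Type*} (b : V → S) (_hb : ∀ x, star (b x) = b x) :=
  Submodule.span ℂ (Set.range b)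

namespace SelfAdjSpan

variable {V : Type*} {b : V → S} {hb : ∀ x, star (b x) = b x}

theorem star_mem (hb : ∀ x, star (b x) = b x) {s : S} (hs : s ∈ Submodule.span ℂ (Set.range b)) :
    star s ∈ Submodule.span ℂ (Set.range b) := by
  induction hs using Submodule.span_induction with
  | mem s hs =>
    obtain ⟨x, rfl⟩ := hs
    rw [hb]
    exact Submodule.subset_span ⟨x, rfl⟩
  | zero => rw [star_zero]; exact Submodule.zero_mem _
  | add s t _ _ h h' => rw [star_add]; exact Submodule.add_mem _ h h'
  | smul z s _ h => rw [star_smul]; exact Submodule.smul_mem _ _ h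

instance : AddCommGroup (SelfAdjSpan b hb) :=
  inferInstanceAs (AddCommGroup (Submodule.span ℂ (Set.range b)))
instance : Module ℂ (SelfAdjSpan b hb) :=
  inferInstanceAs (Module ℂ (Submodule.span ℂ (Set.range b)))
instance : StarAddMonoid (SelfAdjSpan b hb) where
  star s := ⟨star s.1, star_mem hb s.2⟩
  star_involutive s := Subtype.ext (star_star s.1)
  star_add s t := Subtype.ext (star_add s.1 t.1)
instance : StarModule ℂ (SelfAdjSpan b hb) where
  star_smul z s := Subtype.ext (star_smul z s.1)

/-- The inclusion of the span. -/
def incl (b : V → S) (hb : ∀ x, star (b x) = b x) : SelfAdjSpan b hb →ₗ[ℂ] S :=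
  (Submodule.span ℂ (Set.range b)).subtype

theorem incl_injective : Function.Injective (incl b hb) := Subtype.val_injective

theorem incl_star (s : SelfAdjSpan b hb) : incl b hb (star s) = star (incl b hb s) := rfl

/-- The generators of the span. -/
def gen (b : V → S) (hb : ∀ x, star (b x) = b x) (x : V) : SelfAdjSpan b hb :=
  ⟨b x, Submodule.subset_span ⟨x, rfl⟩⟩

theorem map_conjTranspose {n : ℕ} (a : Matrix (Fin n) (Fin n) (SelfAdjSpan b hb)) :
    a.conjTranspose.map (incl b hb) = (a.map (incl b hb)).conjTranspose := rfl

theorem map_add' {n : ℕ} (a c : Matrix (Fin n) (Fin n) (SelfAdjSpan b hb)) :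
    (a + c).map (incl b hb) = a.map (incl b hb) + c.map (incl b hb) := rfl

theorem map_smul' {n : ℕ} (z : ℂ) (a : Matrix (Fin n) (Fin n) (SelfAdjSpan b hb)) :
    (z • a).map (incl b hb) = z • a.map (incl b hb) := rfl

theorem map_diag (n : ℕ) (s : SelfAdjSpan b hb) :
    (diag n s).map (incl b hb) = diag n (incl b hb s) :=
  Matrix.diagonal_map (map_zero _)

theorem map_injective {n : ℕ} {a c : Matrix (Fin n) (Fin n) (SelfAdjSpan b hb)}
    (h : a.map (incl b hb) = c.map (incl b hb)) : a = c :=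
  Matrix.map_injective incl_injective h

end SelfAdjSpan

/-- The operator subsystem spanned by a family of self-adjoint elements whose span contains the
unit; its matrix cones are inherited from the ambient operator system. -/
def subsystem (X : OperatorSystem S) {V : Type*} (b : V → S) (hb : ∀ x, star (b x) = b x)
    (h1 : X.unit ∈ Submodule.span ℂ (Set.range b)) : OperatorSystem (SelfAdjSpan b hb) where
  pos n := {a | a.map (SelfAdjSpan.incl b hb) ∈ X.pos n}
  unit := ⟨X.unit, h1⟩
  star_unit := Subtype.ext X.star_unit
  conjTranspose_eq n a ha := SelfAdjSpan.map_injective (X.conjTranspose_eq n _ ha)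
  zero_mem n := by
    have := X.zero_mem n
    rwa [← Matrix.map_zero (SelfAdjSpan.incl b hb) (map_zero _)] at this
  add_mem n a ha c hc := X.add_mem n _ ha _ hc
  smul_mem n r hr a ha := X.smul_mem n r hr _ ha
  proper n a ha hc := SelfAdjSpan.map_injective (by
    rw [Matrix.map_zero _ (map_zero _)]
    exact X.proper n _ ha hc)
  compress_mem n m t a ha := by
    have := X.compress_mem n m t _ ha
    rwa [← compress_map] at this
  orderUnit n a ha := by
    obtain ⟨r, hr, h⟩ := X.orderUnit n (a.map (SelfAdjSpan.incl b hb))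
      (by rw [← SelfAdjSpan.map_conjTranspose, ha])
    refine ⟨r, hr, ?_⟩
    change _ ∈ X.pos n
    rwa [SelfAdjSpan.map_add', SelfAdjSpan.map_smul', SelfAdjSpan.map_diag]
  archimedean n a ha h := by
    refine X.archimedean n _ (by rw [← SelfAdjSpan.map_conjTranspose, ha]) fun r hr => ?_
    have := h r hr
    change _ ∈ X.pos n at this
    rwa [SelfAdjSpan.map_add', SelfAdjSpan.map_smul', SelfAdjSpan.map_diag] at this

end Subsystem

section Quotient

/-- Kernels: intersections of kernels of states. -/
def IsKernel (X : OperatorSystem S) (J : Submodule ℂ S) : Prop :=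
  ∃ F : Set (S →ₗ[ℂ] ℂ), (∀ f ∈ F, X.IsState f) ∧ ∀ u, u ∈ J ↔ ∀ f ∈ F, f u = 0

theorem IsState.map_star {X : OperatorSystem S} {f : S →ₗ[ℂ] ℂ} (hf : X.IsState f) (s : S) :
    f (star s) = star (f s) := by
  have herm : ∀ t : S, star t = t → star (f t) = f t := fun t ht => by
    obtain ⟨r, hr, h⟩ := X.toAOUSpace.orderUnit t ht
    have h1 := hf.2 _ h
    have e : f ((r : ℂ) • X.toAOUSpace.unit + t) = r + f t := by
      rw [map_add, map_smul]
      change (r : ℂ) • f X.unit + _ = _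
      rw [hf.1, smul_eq_mul, mul_one]
    rw [e] at h1
    have h2 := (IsSelfAdjoint.of_nonneg h1).star_eq
    rw [star_add, Complex.star_def, Complex.conj_ofReal] at h2
    exact add_left_cancel h2
  have h1 := herm (s + star s) (by rw [star_add, star_star, add_comm])
  have h2 := herm (Complex.I • (s - star s)) (by
    rw [star_smul, star_sub, star_star, Complex.star_def, Complex.conj_I, neg_smul, ← smul_neg,
      neg_sub])
  rw [map_add, star_add] at h1
  rw [map_smul, map_sub, star_smul, star_sub, Complex.star_def, Complex.conj_I, smul_eq_mul,
    smul_eq_mul, neg_mul, ← mul_neg, neg_sub] at h2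
  have h3 := mul_left_cancel₀ Complex.I_ne_zero h2
  simp only [Complex.star_def] at h1 h3 ⊢
  linear_combination (h3 - h1) / 2

theorem IsKernel.star_mem {X : OperatorSystem S} {J : Submodule ℂ S} (hJ : X.IsKernel J) {u : S}
    (hu : u ∈ J) : star u ∈ J := by
  obtain ⟨F, hF, h⟩ := hJ
  rw [h] at hu ⊢
  intro f hf
  rw [(hF f hf).map_star, hu f hf, star_zero]

/-- The quotient vector space by a kernel. -/
@[nolint unusedArguments]
def Quot (X : OperatorSystem S) (J : Submodule ℂ S) (_hJ : X.IsKernel J) := S ⧸ J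

namespace Quot

variable {X : OperatorSystem S} {J : Submodule ℂ S} {hJ : X.IsKernel J}

instance : AddCommGroup (X.Quot J hJ) := inferInstanceAs (AddCommGroup (S ⧸ J))
instance : Module ℂ (X.Quot J hJ) := inferInstanceAs (Module ℂ (S ⧸ J))

/-- The quotient map. -/
def mk (X : OperatorSystem S) (J : Submodule ℂ S) (hJ : X.IsKernel J) : S →ₗ[ℂ] X.Quot J hJ :=
  J.mkQ

theorem mk_surjective : Function.Surjective (mk X J hJ) := J.mkQ_surjective

theorem mk_eq_zero {u : S} : mk X J hJ u = 0 ↔ u ∈ J := Submodule.Quotient.mk_eq_zero J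

instance : Star (X.Quot J hJ) where
  star := Quotient.map' (s₁ := J.quotientRel) (s₂ := J.quotientRel) star fun s t h => by
    rw [Submodule.quotientRel_def] at h ⊢
    rw [← star_sub]
    exact hJ.star_mem h

theorem mk_star (s : S) : star (mk X J hJ s) = mk X J hJ (star s) := rfl

instance : StarAddMonoid (X.Quot J hJ) where
  star_involutive s := by
    obtain ⟨s, rfl⟩ := mk_surjective s
    rw [mk_star, mk_star, star_star]
  star_add s t := by
    obtain ⟨s, rfl⟩ := mk_surjective s
    obtain ⟨t, rfl⟩ := mk_surjective t
    rw [← map_add, mk_star, mk_star, mk_star, star_add, map_add]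

instance : StarModule ℂ (X.Quot J hJ) where
  star_smul z s := by
    obtain ⟨s, rfl⟩ := mk_surjective s
    rw [← map_smul, mk_star, mk_star, star_smul, map_smul]

theorem map_conjTranspose {n : ℕ} (a : Matrix (Fin n) (Fin n) S) :
    a.conjTranspose.map (mk X J hJ) = (a.map (mk X J hJ)).conjTranspose := rfl

theorem map_diag (n : ℕ) (s : S) : (diag n s).map (mk X J hJ) = diag n (mk X J hJ s) :=
  Matrix.diagonal_map (map_zero _)

theorem exists_map {n : ℕ} (a : Matrix (Fin n) (Fin n) (X.Quot J hJ)) :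
    ∃ b : Matrix (Fin n) (Fin n) S, b.map (mk X J hJ) = a := by
  choose b hb using fun i j => mk_surjective (a i j)
  exact ⟨Matrix.of b, by ext i j; exact hb i j⟩

end Quot

/-- The quotient operator system: `a` is positive in `M_n(S/J)` if and only if `r 1 + a` has a
positive lift in `M_n(S)` for every `r > 0`. -/
def quotient (X : OperatorSystem S) (J : Submodule ℂ S) (hJ : X.IsKernel J) :
    OperatorSystem (X.Quot J hJ) where
  pos n := {a | ∀ r : ℝ, 0 < r → ∃ b ∈ X.pos n,
    b.map (Quot.mk X J hJ) = (r : ℂ) • diag n (Quot.mk X J hJ X.unit) + a}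
  unit := Quot.mk X J hJ X.unit
  star_unit := by rw [Quot.mk_star, X.star_unit]
  conjTranspose_eq n a ha := by
    obtain ⟨b, hb, h⟩ := ha 1 one_pos
    have h' := congrArg Matrix.conjTranspose h
    rw [← Quot.map_conjTranspose, X.conjTranspose_eq n b hb, h, Matrix.conjTranspose_add,
      Matrix.conjTranspose_smul, diag_conjTranspose _ (by rw [Quot.mk_star, X.star_unit]),
      Complex.star_def, Complex.conj_ofReal] at h'
    exact (add_left_cancel h').symm
  zero_mem n r hr := ⟨_, X.smul_diag_mem n hr.le, by
    rw [add_zero, ← Quot.map_diag]; rfl⟩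
  add_mem n a ha b hb r hr := by
    obtain ⟨c, hc, h⟩ := ha (r / 2) (by positivity)
    obtain ⟨d, hd, h'⟩ := hb (r / 2) (by positivity)
    refine ⟨c + d, X.add_mem n c hc d hd, ?_⟩
    rw [Matrix.map_add _ (map_add _), h, h']
    push_cast
    module
  smul_mem n t ht a ha r hr := by
    obtain ⟨c, hc, h⟩ := ha (r / (t + 1)) (by positivity)
    refine ⟨(t : ℂ) • c + ((r / (t + 1) : ℝ) : ℂ) • diag n X.unit,
      X.add_mem n _ (X.smul_mem n t ht c hc) _ (X.smul_diag_mem n (by positivity)), ?_⟩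
    rw [Matrix.map_add _ (map_add _), Matrix.map_smul _ _ (fun _ => map_smul _ _ _),
      Matrix.map_smul _ _ (fun _ => map_smul _ _ _), h, Quot.map_diag]
    have : (r : ℂ) = t * (r / (t + 1) : ℝ) + (r / (t + 1) : ℝ) := by
      rw [← Complex.ofReal_mul, ← Complex.ofReal_add]
      congr 1
      field_simp
    rw [this]
    module
  proper n a ha hna := by
    obtain ⟨c, rfl⟩ := Quot.exists_map a
    refine quad_polar fun l => ?_
    rw [quad_map, Quot.mk_eq_zero]
    obtain ⟨F, hF, hJF⟩ := id hJ
    have step : ∀ f ∈ F, ∀ d : Matrix (Fin n) (Fin n) S,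
        (∀ r : ℝ, 0 < r → ∃ b ∈ X.pos n, b.map (Quot.mk X J hJ) =
          (r : ℂ) • diag n (Quot.mk X J hJ X.unit) + d.map (Quot.mk X J hJ)) →
        0 ≤ f (quad d l) := by
      intro f hf d hd
      set L : ℝ := ∑ i, ‖l i‖ ^ 2
      have hL0 : 0 ≤ L := Finset.sum_nonneg fun i _ => by positivity
      have h1 : ∀ r : ℝ, 0 < r → 0 ≤ (r : ℂ) * L + f (quad d l) := fun r hr => by
        obtain ⟨b, hb, h⟩ := hd r hr
        have h2 := X.compress_mem n 1 (Matrix.of fun i (_ : Fin 1) => l i) b hb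
        rw [compress_col] at h2
        have h3 := (hF f hf).2 _ h2
        have h4 : f (quad b l) = f (quad ((r : ℂ) • diag n X.unit + d) l) := by
          rw [← sub_eq_zero, ← map_sub]
          refine (hJF _).1 ?_ f hf
          rw [← Quot.mk_eq_zero (X := X) (hJ := hJ), map_sub, ← quad_map, ← quad_map, h,
            Matrix.map_add _ (map_add _), Matrix.map_smul _ _ (fun _ => map_smul _ _ _),
            Quot.map_diag, sub_self]
        rw [h4, quad_add, quad_smul, quad_diag, map_add, map_smul, map_smul, (hF f hf).1,
          smul_eq_mul, smul_eq_mul, mul_one] at h3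
        exact h3
      have him : (f (quad d l)).im = 0 := by
        have := (Complex.nonneg_iff.1 (h1 1 one_pos)).2
        simpa using this.symm
      have hre : 0 ≤ (f (quad d l)).re := by
        refine le_of_forall_pos_le_add fun ε hε => ?_
        have := (Complex.nonneg_iff.1 (h1 (ε / (L + 1)) (by positivity))).1
        rw [← Complex.ofReal_mul, Complex.add_re, Complex.ofReal_re] at this
        have h5 : ε / (L + 1) * L ≤ ε := by
          rw [div_mul_eq_mul_div, div_le_iff₀ (by positivity)]
          nlinarith
        linarith
      exact Complex.nonneg_iff.2 ⟨hre, him.symm⟩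
    refine (hJF _).2 fun f hf => ?_
    have h1 := step f hf c ha
    have h2 := step f hf (-c) (by
      have : (-c).map (Quot.mk X J hJ) = -c.map (Quot.mk X J hJ) := by ext i j; simp
      rw [this]
      exact hna)
    rw [quad_neg, map_neg] at h2
    exact le_antisymm (neg_nonneg.1 h2) h1
  compress_mem n m t a ha r hr := by
    obtain ⟨c, hc, h⟩ := X.orderUnit m (-compress t (diag n X.unit)) (by
      rw [Matrix.conjTranspose_neg, compress_conjTranspose, diag_conjTranspose _ X.star_unit])
    obtain ⟨b, hb, hb'⟩ := ha (r / c) (by positivity)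
    refine ⟨((r / c : ℝ) : ℂ) • ((c : ℂ) • diag m X.unit + -compress t (diag n X.unit)) +
      compress t b, X.add_mem m _ (X.smul_mem m _ (by positivity) _ h) _
        (X.compress_mem n m t b hb), ?_⟩
    have hneg : (-compress t (diag n X.unit)).map (Quot.mk X J hJ) =
        -(compress t (diag n X.unit)).map (Quot.mk X J hJ) := by ext i j; simp
    rw [Matrix.map_add _ (map_add _), Matrix.map_smul _ _ (fun _ => map_smul _ _ _),
      Matrix.map_add _ (map_add _), Matrix.map_smul _ _ (fun _ => map_smul _ _ _), hneg,
      compress_map, compress_map, hb', compress_add, compress_smul, Quot.map_diag, Quot.map_diag]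
    have : (r : ℂ) = (r / c : ℝ) * c := by
      rw [← Complex.ofReal_mul, div_mul_cancel₀ _ hc.ne']
    rw [this]
    module
  orderUnit n a ha := by
    obtain ⟨c, rfl⟩ := Quot.exists_map a
    set d : Matrix (Fin n) (Fin n) S := (1 / 2 : ℂ) • (c + c.conjTranspose) with hd
    have hdm : d.map (Quot.mk X J hJ) = c.map (Quot.mk X J hJ) := by
      rw [hd, Matrix.map_smul _ _ (fun _ => map_smul _ _ _), Matrix.map_add _ (map_add _),
        Quot.map_conjTranspose, ha]
      module
    obtain ⟨r, hr, h⟩ := X.orderUnit n d (by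
      rw [hd, Matrix.conjTranspose_smul, Matrix.conjTranspose_add,
        Matrix.conjTranspose_conjTranspose, add_comm]
      simp)
    refine ⟨r, hr, fun e he => ⟨(e : ℂ) • diag n X.unit + ((r : ℂ) • diag n X.unit + d),
      X.add_mem n _ (X.smul_diag_mem n he.le) _ h, ?_⟩⟩
    rw [Matrix.map_add _ (map_add _), Matrix.map_add _ (map_add _),
      Matrix.map_smul _ _ (fun _ => map_smul _ _ _), Matrix.map_smul _ _ (fun _ => map_smul _ _ _),
      hdm, Quot.map_diag]
  archimedean n a ha h r hr := by
    obtain ⟨b, hb, hb'⟩ := h (r / 2) (by positivity) (r / 2) (by positivity)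
    refine ⟨b, hb, ?_⟩
    rw [hb']
    push_cast
    module

end Quotient

section CStarAlgebras

section Aux

variable {B : Type*} [CStarAlgebra B]

theorem cstar_add (x y : B) : ∃ c : B, star x * x + star y * y = star c * c := by
  let _ := CStarAlgebra.spectralOrder B
  have _ := CStarAlgebra.spectralOrderedRing B
  exact CStarAlgebra.nonneg_iff_eq_star_mul_self.1
    (add_nonneg (star_mul_self_nonneg x) (star_mul_self_nonneg y))

theorem cstar_sum {n : ℕ} (x : Fin n → B) : ∃ c : B, ∑ k, star (x k) * x k = star c * c := by
  let _ := CStarAlgebra.spectralOrder B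
  have _ := CStarAlgebra.spectralOrderedRing B
  exact CStarAlgebra.nonneg_iff_eq_star_mul_self.1
    (Finset.sum_nonneg fun k _ => star_mul_self_nonneg (x k))

theorem cstar_proper {a x y : B} (h : a = star x * x) (h' : -a = star y * y) : a = 0 := by
  let _ := CStarAlgebra.spectralOrder B
  have _ := CStarAlgebra.spectralOrderedRing B
  refine le_antisymm (neg_nonneg.1 ?_) ?_
  · rw [h']
    exact star_mul_self_nonneg y
  · rw [h]
    exact star_mul_self_nonneg x

theorem cstar_orderUnit {a : B} (ha : star a = a) :
    ∃ r : ℝ, 0 < r ∧ ∃ c : B, (r : ℂ) • 1 + a = star c * c := by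
  let _ := CStarAlgebra.spectralOrder B
  have _ := CStarAlgebra.spectralOrderedRing B
  have hsa : IsSelfAdjoint a := ha
  refine ⟨‖a‖ + 1, by positivity, CStarAlgebra.nonneg_iff_eq_star_mul_self.1 ?_⟩
  have h1 := hsa.neg_algebraMap_norm_le_self
  rw [neg_le_iff_add_nonneg, Algebra.algebraMap_eq_smul_one] at h1
  have h2 : (0 : B) ≤ 1 := zero_le_one
  have h3 := add_nonneg h2 h1
  convert h3 using 1
  rw [Complex.coe_smul, add_smul, one_smul]
  abel

theorem cstar_archimedean {a : B}
    (h : ∀ r : ℝ, 0 < r → ∃ c : B, (r : ℂ) • 1 + a = star c * c) : ∃ c : B, a = star c * c := by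
  let _ := CStarAlgebra.spectralOrder B
  have _ := CStarAlgebra.spectralOrderedRing B
  refine CStarAlgebra.nonneg_iff_eq_star_mul_self.1 ?_
  have hlim : Filter.Tendsto (fun r : ℝ => (r : ℂ) • (1 : B) + a) (nhdsWithin 0 (Set.Ioi 0))
      (nhds a) := by
    have hc : Continuous fun r : ℝ => (r : ℂ) • (1 : B) + a := by fun_prop
    have := (hc.tendsto 0).mono_left (nhdsWithin_le_nhds (s := Set.Ioi 0))
    simpa using this
  refine CStarAlgebra.isClosed_nonneg.mem_of_tendsto hlim ?_
  filter_upwards [self_mem_nhdsWithin] with r hr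
  obtain ⟨c, hc⟩ := h r hr
  exact hc ▸ star_mul_self_nonneg c

end Aux

variable (A : Type*) [CStarAlgebra A]

/-- A unital C*-algebra `A` as an operator system: the positive elements of the C*-algebra
`M_n(A)` are those of the form `b* b` with `b ∈ M_n(A)`. -/
def ofCStarAlgebra : OperatorSystem A where
  pos n := {a | ∃ b : Matrix (Fin n) (Fin n) A, a = b.conjTranspose * b}
  unit := 1
  star_unit := star_one A
  conjTranspose_eq n a ha := by
    obtain ⟨b, rfl⟩ := ha
    rw [Matrix.conjTranspose_mul, Matrix.conjTranspose_conjTranspose]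
  zero_mem n := ⟨0, by simp⟩
  add_mem n a ha b hb := by
    let _ := CStarAlgebra.spectralOrder A
    have _ := CStarAlgebra.spectralOrderedRing A
    obtain ⟨x, rfl⟩ := ha
    obtain ⟨y, rfl⟩ := hb
    exact @cstar_add (CStarMatrix (Fin n) (Fin n) A) CStarMatrix.instCStarAlgebra x y
  smul_mem n r hr a ha := by
    obtain ⟨b, rfl⟩ := ha
    refine ⟨((√r : ℝ) : ℂ) • b, ?_⟩
    rw [Matrix.conjTranspose_smul, Matrix.smul_mul, Matrix.mul_smul, smul_smul, Complex.star_def,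
      Complex.conj_ofReal, ← Complex.ofReal_mul, Real.mul_self_sqrt hr]
  proper n a ha hb := by
    let _ := CStarAlgebra.spectralOrder A
    have _ := CStarAlgebra.spectralOrderedRing A
    obtain ⟨x, hx⟩ := ha
    obtain ⟨y, hy⟩ := hb
    exact @cstar_proper (CStarMatrix (Fin n) (Fin n) A) CStarMatrix.instCStarAlgebra a x y hx hy
  compress_mem n m t a ha := by
    let _ := CStarAlgebra.spectralOrder A
    have _ := CStarAlgebra.spectralOrderedRing A
    obtain ⟨b, rfl⟩ := ha
    rcases m with _ | m
    · exact ⟨0, Subsingleton.elim _ _⟩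
    set c : Matrix (Fin n) (Fin (m + 1)) A := Matrix.of fun k j => ∑ l, t l j • b k l with hc
    let row : Fin n → Matrix (Fin (m + 1)) (Fin (m + 1)) A := fun k =>
      Matrix.of fun i j => if i = 0 then c k j else 0
    have key : compress t (b.conjTranspose * b) = ∑ k, (row k).conjTranspose * row k := by
      ext i j
      have hr : ∀ k, ((row k).conjTranspose * row k) i j = star (c k i) * c k j := by
        intro k
        rw [Matrix.mul_apply, Finset.sum_eq_single 0]
        · simp [row]
        · intro q _ hq
          simp [row, hq]
        · simp
      rw [Matrix.sum_apply]
      simp only [hr, hc, compress, Matrix.of_apply, Matrix.mul_apply, Matrix.conjTranspose_apply,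
        Finset.smul_sum, star_sum, star_smul, Finset.sum_mul_sum, smul_mul_smul_comm]
      calc _ = ∑ p, ∑ k, ∑ q, (star (t p i) * t q j) • (star (b k p) * b k q) :=
            Finset.sum_congr rfl fun p _ => Finset.sum_comm
        _ = _ := Finset.sum_comm
    rw [key]
    exact @cstar_sum (CStarMatrix (Fin (m + 1)) (Fin (m + 1)) A) CStarMatrix.instCStarAlgebra n _
  orderUnit n a ha := by
    let _ := CStarAlgebra.spectralOrder A
    have _ := CStarAlgebra.spectralOrderedRing A
    exact @cstar_orderUnit (CStarMatrix (Fin n) (Fin n) A) CStarMatrix.instCStarAlgebra a ha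
  archimedean n a ha h := by
    let _ := CStarAlgebra.spectralOrder A
    have _ := CStarAlgebra.spectralOrderedRing A
    exact @cstar_archimedean (CStarMatrix (Fin n) (Fin n) A) CStarMatrix.instCStarAlgebra a h

end CStarAlgebras

end OperatorSystem

/-- A contextuality scenario on a finite vertex set `V`: a hypergraph with a non-empty set of
hyperedges that covers `V`. -/
structure ContextualityScenario (V : Type u) where
  edges : Finset (Finset V)
  edges_nonempty : edges.Nonempty
  cover : ∀ x : V, ∃ e ∈ edges, x ∈ e

namespace ContextualityScenario

variable {V : Type u} (G : ContextualityScenario V)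

/-- Probabilistic models of `G`. -/
def models : Set (V → ℝ) :=
  {p | (∀ x, p x ∈ Set.Icc (0 : ℝ) 1) ∧ ∀ e ∈ G.edges, ∑ x ∈ e, p x = 1}

/-- Deterministic models of `G`. -/
def deterministicModels : Set (V → ℝ) :=
  {p | p ∈ G.models ∧ ∀ x, p x = 0 ∨ p x = 1}

/-- Classical models of `G`: convex combinations of deterministic ones. -/
def classicalModels : Set (V → ℝ) := convexHull ℝ G.deterministicModels

/-- A projective representation of `G` on a Hilbert space. -/
structure ProjRep where
  H : Type u
  [normed : NormedAddCommGroup H]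
  [inner : InnerProductSpace ℂ H]
  [complete : CompleteSpace H]
  P : V → (H →L[ℂ] H)
  proj : ∀ x, IsStarProjection (P x)
  sum_eq : ∀ e ∈ G.edges, ∑ x ∈ e, P x = 1

attribute [instance] ProjRep.normed ProjRep.inner ProjRep.complete

/-- Quantum models of `G`. -/
def quantumModels : Set (V → ℝ) :=
  {p | ∃ (R : G.ProjRep) (ψ : R.H), ‖ψ‖ = 1 ∧ ∀ x, (p x : ℂ) = inner ℂ ψ (R.P x ψ)}

/-! ### The hypergraph C*-algebra -/

/-- The conjugate-linear map on the free algebra that reverses words and conjugates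
coefficients. -/
noncomputable def conjReverse (V : Type u) :
    MonoidAlgebra ℂ (FreeMonoid V) →+ MonoidAlgebra ℂ (FreeMonoid V) where
  toFun a := MonoidAlgebra.ofCoeff ((a.coeff.mapDomain star).mapRange (starRingEnd ℂ) (map_zero _))
  map_zero' := congrArg MonoidAlgebra.ofCoeff
    (by rw [MonoidAlgebra.coeff_zero, Finsupp.mapDomain_zero, Finsupp.mapRange_zero])
  map_add' a b := congrArg MonoidAlgebra.ofCoeff (by
    rw [MonoidAlgebra.coeff_add, Finsupp.mapDomain_add, Finsupp.mapRange_add (map_add _)]; rfl)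

theorem conjReverse_single (w : FreeMonoid V) (c : ℂ) :
    conjReverse V (MonoidAlgebra.single w c) = MonoidAlgebra.single (star w) (star c) := by
  refine congrArg MonoidAlgebra.ofCoeff ?_
  rw [MonoidAlgebra.coeff_single, Finsupp.mapDomain_single, Finsupp.mapRange_single]
  rfl

/-- The free unital complex *-algebra on self-adjoint generators indexed by `V`: linear
combinations of words in `V`. The scenario is recorded in the type since it determines the
seminorm below. -/
@[nolint unusedArguments]
def FreeStarAlg (_G : ContextualityScenario V) : Type u := MonoidAlgebra ℂ (FreeMonoid V)

noncomputable instance : Ring G.FreeStarAlg := inferInstanceAs (Ring (MonoidAlgebra ℂ (FreeMonoid V)))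
noncomputable instance : Algebra ℂ G.FreeStarAlg :=
  inferInstanceAs (Algebra ℂ (MonoidAlgebra ℂ (FreeMonoid V)))

namespace FreeStarAlg

/-- The word `w` with coefficient `c`. -/
noncomputable def word (w : FreeMonoid V) (c : ℂ) : G.FreeStarAlg := MonoidAlgebra.single w c

variable {G}

theorem word_mul (w w' : FreeMonoid V) (c c' : ℂ) :
    word G w c * word G w' c' = word G (w * w') (c * c') :=
  MonoidAlgebra.single_mul_single ..

theorem one_eq : (1 : G.FreeStarAlg) = word G 1 1 := rfl

theorem smul_word (z : ℂ) (w : FreeMonoid V) (c : ℂ) : z • word G w c = word G w (z * c) :=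
  MonoidAlgebra.smul_single' ..

theorem induction {motive : G.FreeStarAlg → Prop} (a : G.FreeStarAlg) (zero : motive 0)
    (add : ∀ a b, motive a → motive b → motive (a + b)) (wd : ∀ w c, motive (word G w c)) :
    motive a :=
  MonoidAlgebra.induction_linear (motive := motive) a zero add wd

/-- The involution on `G.FreeStarAlg`. -/
noncomputable def starHom : G.FreeStarAlg →+ G.FreeStarAlg := conjReverse V

theorem starHom_word (w : FreeMonoid V) (c : ℂ) :
    starHom (word G w c) = word G (star w) (star c) :=
  conjReverse_single w c

noncomputable instance : StarRing G.FreeStarAlg where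
  star := starHom
  star_involutive a := by
    induction a using FreeStarAlg.induction with
    | zero => simp
    | add a b ha hb => rw [map_add, map_add, ha, hb]
    | wd w c => rw [starHom_word, starHom_word, star_star, star_star]
  star_mul a b := by
    induction a using FreeStarAlg.induction with
    | zero => simp
    | add a a' ha ha' => rw [add_mul, map_add, map_add, ha, ha', mul_add]
    | wd w c =>
      induction b using FreeStarAlg.induction with
      | zero => simp
      | add a a' ha ha' => rw [mul_add, map_add, map_add, ha, ha', add_mul]
      | wd w' c' =>
        simp only [word_mul, starHom_word, star_mul]
  star_add := map_add starHom

theorem star_word (w : FreeMonoid V) (c : ℂ) :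
    star (word G w c) = word G (star w) (star c) := starHom_word w c

instance : StarModule ℂ G.FreeStarAlg where
  star_smul z a := by
    induction a using FreeStarAlg.induction with
    | zero => simp
    | add a b ha hb => rw [smul_add, star_add, star_add, smul_add, ha, hb]
    | wd w c => rw [smul_word, star_word, star_word, smul_word, star_mul']

/-- The generator attached to the vertex `x`. -/
noncomputable def gen (x : V) : G.FreeStarAlg := word G (FreeMonoid.of x) 1

theorem star_gen (x : V) : star (gen x : G.FreeStarAlg) = gen x := by
  rw [gen, star_word, FreeMonoid.star_of, star_one]

/-- The evaluation of *-polynomials at a projective representation. -/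
noncomputable def eval (R : G.ProjRep) : G.FreeStarAlg →ₐ[ℂ] (R.H →L[ℂ] R.H) :=
  MonoidAlgebra.lift ℂ (R.H →L[ℂ] R.H) (FreeMonoid V) (FreeMonoid.lift R.P)

theorem eval_word (R : G.ProjRep) (w : FreeMonoid V) (c : ℂ) :
    eval R (word G w c) = c • FreeMonoid.lift R.P w := MonoidAlgebra.lift_single ..

theorem eval_gen (R : G.ProjRep) (x : V) : eval R (gen x) = R.P x := by
  rw [gen, eval_word, FreeMonoid.lift_eval_of, one_smul]

theorem lift_star (R : G.ProjRep) (w : FreeMonoid V) :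
    FreeMonoid.lift R.P (star w) = star (FreeMonoid.lift R.P w) := by
  induction w using FreeMonoid.inductionOn' with
  | one => simp
  | of_mul x w ih =>
    rw [star_mul, map_mul, ih, FreeMonoid.star_of, map_mul, star_mul, FreeMonoid.lift_eval_of,
      (R.proj x).isSelfAdjoint.star_eq]

theorem eval_star (R : G.ProjRep) (a : G.FreeStarAlg) : eval R (star a) = star (eval R a) := by
  induction a using FreeStarAlg.induction with
  | zero => simp
  | add a b ha hb => simp only [star_add, map_add, ha, hb]
  | wd w c => rw [star_word, eval_word, eval_word, star_smul, lift_star]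

theorem norm_lift_le (R : G.ProjRep) (w : FreeMonoid V) : ‖FreeMonoid.lift R.P w‖ ≤ 1 := by
  induction w using FreeMonoid.inductionOn' with
  | one =>
    rw [map_one]
    exact ContinuousLinearMap.norm_id_le
  | of_mul x w ih =>
    rw [map_mul, FreeMonoid.lift_eval_of]
    exact (norm_mul_le _ _).trans (mul_le_one₀ ((R.proj x).norm_le) (norm_nonneg _) ih)

theorem exists_bound (a : G.FreeStarAlg) : ∃ C : ℝ, ∀ R : G.ProjRep, ‖eval R a‖ ≤ C := by
  induction a using FreeStarAlg.induction with
  | zero => exact ⟨0, fun R => by simp⟩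
  | add a b ha hb =>
    obtain ⟨C, hC⟩ := ha
    obtain ⟨D, hD⟩ := hb
    exact ⟨C + D, fun R => by
      rw [map_add]; exact (norm_add_le _ _).trans (add_le_add (hC R) (hD R))⟩
  | wd w c =>
    refine ⟨‖c‖, fun R => ?_⟩
    rw [eval_word, norm_smul]
    exact mul_le_of_le_one_right (norm_nonneg _) (norm_lift_le R w)

/-- The universal C*-seminorm: the supremum over all projective representations. -/
noncomputable def univNorm (a : G.FreeStarAlg) : ℝ := ⨆ R : G.ProjRep, ‖eval R a‖

theorem le_univNorm (R : G.ProjRep) (a : G.FreeStarAlg) : ‖eval R a‖ ≤ univNorm a := by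
  obtain ⟨C, hC⟩ := exists_bound a
  exact le_ciSup (f := fun R : G.ProjRep => ‖eval R a‖) ⟨C, by rintro _ ⟨R, rfl⟩; exact hC R⟩ R

theorem univNorm_le {a : G.FreeStarAlg} {C : ℝ} (h0 : 0 ≤ C)
    (h : ∀ R : G.ProjRep, ‖eval R a‖ ≤ C) : univNorm a ≤ C := Real.iSup_le h h0

theorem univNorm_nonneg (a : G.FreeStarAlg) : 0 ≤ univNorm a :=
  Real.iSup_nonneg fun _ => norm_nonneg _

theorem univNorm_mul (a b : G.FreeStarAlg) : univNorm (a * b) ≤ univNorm a * univNorm b := by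
  refine univNorm_le (mul_nonneg (univNorm_nonneg a) (univNorm_nonneg b)) fun R => ?_
  rw [map_mul]
  exact (norm_mul_le _ _).trans
    (mul_le_mul (le_univNorm R a) (le_univNorm R b) (norm_nonneg _) (univNorm_nonneg a))

/-- `univNorm` as a seminorm of additive groups. -/
noncomputable def univSeminorm : AddGroupSeminorm G.FreeStarAlg where
  toFun := univNorm
  map_zero' := le_antisymm (univNorm_le le_rfl fun R => by simp) (univNorm_nonneg 0)
  add_le' a b := by
    refine univNorm_le (add_nonneg (univNorm_nonneg a) (univNorm_nonneg b)) fun R => ?_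
    rw [map_add]
    exact (norm_add_le _ _).trans (add_le_add (le_univNorm R a) (le_univNorm R b))
  neg' a := by simp only [univNorm, map_neg, norm_neg]

noncomputable instance : SeminormedRing G.FreeStarAlg where
  __ := (inferInstance : Ring G.FreeStarAlg)
  __ := (univSeminorm (G := G)).toSeminormedAddCommGroup
  norm_mul_le := univNorm_mul

theorem norm_def (a : G.FreeStarAlg) : ‖a‖ = univNorm a := rfl

noncomputable instance : NormedAlgebra ℂ G.FreeStarAlg where
  norm_smul_le z a := by
    refine univNorm_le (mul_nonneg (norm_nonneg z) (univNorm_nonneg a)) fun R => ?_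
    rw [map_smul, norm_smul]
    exact mul_le_mul_of_nonneg_left (le_univNorm R a) (norm_nonneg z)

theorem norm_star (a : G.FreeStarAlg) : ‖star a‖ = ‖a‖ := by
  simp only [norm_def, univNorm, eval_star, _root_.norm_star]

theorem norm_mul_self_le (a : G.FreeStarAlg) : ‖a‖ * ‖a‖ ≤ ‖star a * a‖ := by
  have h : ‖a‖ ≤ √‖star a * a‖ := by
    refine univNorm_le (Real.sqrt_nonneg _) fun R => Real.le_sqrt_of_sq_le ?_
    have := le_univNorm R (star a * a)
    rwa [map_mul, eval_star, CStarRing.norm_star_mul_self, ← sq] at this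
  calc ‖a‖ * ‖a‖ ≤ √‖star a * a‖ * √‖star a * a‖ := 
        mul_le_mul h h (norm_nonneg _) (Real.sqrt_nonneg _)
    _ = ‖star a * a‖ := Real.mul_self_sqrt (norm_nonneg _)

theorem isometry_star : Isometry (star : G.FreeStarAlg → G.FreeStarAlg) :=
  AddMonoidHomClass.isometry_of_norm (starHom (G := G)) norm_star

end FreeStarAlg

/-- The hypergraph C*-algebra `C*(G)`: the universal C*-algebra generated by projections `p_x`
with `∑ x ∈ e, p_x = 1` for all hyperedges `e`, realised as the Hausdorff completion of the free
*-algebra in the supremum of the seminorms given by the projective representations of `G`. -/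
def CStar : Type u := UniformSpace.Completion G.FreeStarAlg

namespace CStar

noncomputable instance : NormedRing G.CStar :=
  inferInstanceAs (NormedRing (UniformSpace.Completion G.FreeStarAlg))
instance : CompleteSpace G.CStar :=
  inferInstanceAs (CompleteSpace (UniformSpace.Completion G.FreeStarAlg))
noncomputable instance : Algebra ℂ G.CStar :=
  inferInstanceAs (Algebra ℂ (UniformSpace.Completion G.FreeStarAlg))
noncomputable instance : NormedAlgebra ℂ G.CStar where
  norm_smul_le := (inferInstance : NormedSpace ℂ (UniformSpace.Completion G.FreeStarAlg)).norm_smul_le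

variable {G}

/-- The canonical map from the free *-algebra. -/
noncomputable def ofFree : G.FreeStarAlg →ₐ[ℂ] G.CStar where
  __ := (UniformSpace.Completion.coeRingHom : G.FreeStarAlg →+* UniformSpace.Completion G.FreeStarAlg)
  commutes' _ := rfl

theorem norm_ofFree (a : G.FreeStarAlg) : ‖ofFree a‖ = ‖a‖ := UniformSpace.Completion.norm_coe a

theorem isometry_ofFree : Isometry (ofFree (G := G)) :=
  AddMonoidHomClass.isometry_of_norm _ norm_ofFree

theorem denseRange_ofFree : DenseRange (ofFree (G := G)) := UniformSpace.Completion.denseRange_coe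

noncomputable instance : Star G.CStar :=
  ⟨UniformSpace.Completion.map (star : G.FreeStarAlg → G.FreeStarAlg)⟩

theorem star_ofFree (a : G.FreeStarAlg) : star (ofFree a) = ofFree (star a) :=
  UniformSpace.Completion.map_coe FreeStarAlg.isometry_star.uniformContinuous a

theorem continuous_star' : Continuous (star : G.CStar → G.CStar) :=
  UniformSpace.Completion.continuous_map

noncomputable instance : StarRing G.CStar where
  star_involutive a := by
    refine denseRange_ofFree.induction_on (p := fun a : G.CStar => star (star a) = a) a
      (isClosed_eq (continuous_star'.comp continuous_star') continuous_id) fun a => ?_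
    rw [star_ofFree, star_ofFree, star_star]
  star_mul a b := by
    refine denseRange_ofFree.induction_on₂ (p := fun a b : G.CStar => star (a * b) = star b * star a)
      (isClosed_eq (continuous_star'.comp continuous_mul)
        ((continuous_star'.comp continuous_snd).mul (continuous_star'.comp continuous_fst)))
      (fun a b => ?_) a b
    rw [← map_mul, star_ofFree, star_ofFree, star_ofFree, star_mul, map_mul]
  star_add a b := by
    refine denseRange_ofFree.induction_on₂ (p := fun a b : G.CStar => star (a + b) = star a + star b)
      (isClosed_eq (continuous_star'.comp continuous_add)
        ((continuous_star'.comp continuous_fst).add (continuous_star'.comp continuous_snd)))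
      (fun a b => ?_) a b
    rw [← map_add, star_ofFree, star_ofFree, star_ofFree, star_add, map_add]

noncomputable instance : CStarAlgebra G.CStar where
  norm_mul_self_le a := by
    refine denseRange_ofFree.induction_on (p := fun a : G.CStar => ‖a‖ * ‖a‖ ≤ ‖star a * a‖) a
      (isClosed_le (continuous_norm.mul continuous_norm)
        (continuous_norm.comp (continuous_star'.mul continuous_id))) fun a => ?_
    rw [star_ofFree, ← map_mul, norm_ofFree, norm_ofFree]
    exact FreeStarAlg.norm_mul_self_le a
  star_smul z a := by
    refine denseRange_ofFree.induction_on (p := fun a : G.CStar => star (z • a) = star z • star a) a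
      (isClosed_eq (continuous_star'.comp (continuous_const_smul z))
        (continuous_star'.const_smul (star z))) fun a => ?_
    rw [← map_smul, star_ofFree, star_ofFree, star_smul, map_smul]

/-- The canonical projections `p_x`. -/
noncomputable def p (x : V) : G.CStar := ofFree (FreeStarAlg.gen x)

theorem ofFree_eq_of_eval {a b : G.FreeStarAlg}
    (h : ∀ R : G.ProjRep, FreeStarAlg.eval R a = FreeStarAlg.eval R b) : ofFree a = ofFree b := by
  rw [← sub_eq_zero, ← map_sub, ← norm_eq_zero, norm_ofFree]
  refine le_antisymm (FreeStarAlg.univNorm_le le_rfl fun R => ?_) (norm_nonneg _)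
  rw [map_sub, h R, sub_self, norm_zero]

theorem isStarProjection_p (x : V) : IsStarProjection (p x : G.CStar) where
  isIdempotentElem := by
    rw [IsIdempotentElem, p, ← map_mul]
    refine ofFree_eq_of_eval fun R => ?_
    rw [map_mul, FreeStarAlg.eval_gen]
    exact (R.proj x).isIdempotentElem
  isSelfAdjoint := by
    rw [IsSelfAdjoint, p, star_ofFree, FreeStarAlg.star_gen]

theorem sum_p {e : Finset V} (he : e ∈ G.edges) : ∑ x ∈ e, (p x : G.CStar) = 1 := by
  simp only [p]
  rw [← map_sum, ← map_one ofFree]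
  refine ofFree_eq_of_eval fun R => ?_
  simp only [map_sum, FreeStarAlg.eval_gen, map_one]
  exact R.sum_eq e he

end CStar

end ContextualityScenario

/-! ### The operator systems of a contextuality scenario -/

namespace ContextualityScenario

variable {V : Type u} (G : ContextualityScenario V)

/-- The hyperedges of `G`. -/
abbrev Edge : Type u := {e : Finset V // e ∈ G.edges}

/-- The vertices of a hyperedge. -/
abbrev Edge.Vertex {G : ContextualityScenario V} (e : G.Edge) : Type u := {x : V // x ∈ e.1}

instance : Nonempty G.Edge := G.edges_nonempty.to_subtype

/-- A hyperedge containing `x`. -/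
noncomputable def edgeOf (x : V) : G.Edge := ⟨(G.cover x).choose, (G.cover x).choose_spec.1⟩

theorem mem_edgeOf (x : V) : x ∈ (G.edgeOf x).1 := (G.cover x).choose_spec.2

/-! #### The universal operator system of general models -/

/-- The C*-algebra `⊕_{e ∈ E} ℓ^∞_e`. -/
abbrev EdgeSum : Type u := ∀ e : G.Edge, e.Vertex → ℂ

/-- The element `δ_x^e` of the summand `ℓ^∞_e`, in `⊕_{e ∈ E} ℓ^∞_e`. -/
noncomputable def delta (e : G.Edge) (x : e.Vertex) : G.EdgeSum := by
  classical exact Pi.single e (Pi.single x 1)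

/-- The pairing `⟨p, u⟩ = ∑_{e ∈ E} ∑_{x ∈ e} p(x) u_x^e`. -/
noncomputable def pairing (p : V → ℝ) : G.EdgeSum →ₗ[ℂ] ℂ where
  toFun u := ∑ e : G.Edge, ∑ x : e.Vertex, (p x.1 : ℂ) * u e x
  map_add' u v := by simp [mul_add, Finset.sum_add_distrib]
  map_smul' z u := by simp [Finset.mul_sum, mul_left_comm]

theorem pairing_delta (p : V → ℝ) (e : G.Edge) (x : e.Vertex) :
    G.pairing p (G.delta e x) = p x.1 := by
  classical
  change ∑ f : G.Edge, ∑ y : f.Vertex, (p y.1 : ℂ) * G.delta e x f y = p x.1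
  rw [Finset.sum_eq_single e, Finset.sum_eq_single x]
  · simp [delta]
  · intro y _ hy
    simp [delta, hy]
  · simp
  · intro f _ hf
    simp [delta, hf]
  · simp

theorem pairing_one {p : V → ℝ} (hp : p ∈ G.models) : G.pairing p 1 = (G.edges.card : ℂ) := by
  have h : ∀ e : G.Edge, ∑ x : e.Vertex, (p x.1 : ℂ) = 1 := fun e => by
    have := hp.2 e.1 e.2
    rw [← Finset.sum_coe_sort] at this
    rw [← Complex.ofReal_sum, this, Complex.ofReal_one]
  change ∑ e : G.Edge, ∑ x : e.Vertex, (p x.1 : ℂ) * 1 = _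
  simp only [mul_one, h]
  simp

/-- The subspace of all `u` with `⟨p, u⟩ = 0` for every probabilistic model `p`. -/
noncomputable def nullSpace : Submodule ℂ G.EdgeSum :=
  ⨅ p ∈ G.models, LinearMap.ker (G.pairing p)

theorem mem_nullSpace {u : G.EdgeSum} :
    u ∈ G.nullSpace ↔ ∀ p ∈ G.models, G.pairing p u = 0 := by
  simp [nullSpace, Submodule.mem_iInf]

theorem isKernel_nullSpace :
    (OperatorSystem.ofCStarAlgebra G.EdgeSum).IsKernel G.nullSpace := by
  have hd : (G.edges.card : ℂ) ≠ 0 := by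
    simpa using G.edges_nonempty.ne_empty
  refine ⟨{f | ∃ p ∈ G.models, f = (G.edges.card : ℂ)⁻¹ • G.pairing p}, ?_, fun u => ?_⟩
  · rintro f ⟨p, hp, rfl⟩
    refine ⟨?_, fun s hs => ?_⟩
    · change (G.edges.card : ℂ)⁻¹ * G.pairing p 1 = 1
      rw [G.pairing_one hp, inv_mul_cancel₀ hd]
    · obtain ⟨b, hb⟩ := hs
      have hs' : s = star (b 0 0) * b 0 0 := by
        have := congrFun (congrFun hb 0) 0
        rw [Matrix.mul_apply] at this
        simpa [OperatorSystem.single] using this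
      change 0 ≤ (G.edges.card : ℂ)⁻¹ * ∑ e : G.Edge, ∑ x : e.Vertex, (p x.1 : ℂ) * s e x
      refine mul_nonneg (by rw [inv_nonneg]; exact Nat.cast_nonneg _) (Finset.sum_nonneg fun e _ =>
        Finset.sum_nonneg fun x _ => mul_nonneg (Complex.zero_le_real.2 (hp.1 x.1).1) ?_)
      rw [hs']
      exact star_mul_self_nonneg (b 0 0 e x)
  · rw [mem_nullSpace]
    constructor
    · rintro h f ⟨p, hp, rfl⟩
      rw [LinearMap.smul_apply, h p hp, smul_zero]
    · intro h p hp
      have := h _ ⟨p, hp, rfl⟩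
      rw [LinearMap.smul_apply, smul_eq_mul] at this
      exact (mul_eq_zero.1 this).resolve_left (inv_ne_zero hd)

/-- The underlying vector space of the operator system `S_G`. -/
abbrev SSpace : Type u :=
  OperatorSystem.Quot (OperatorSystem.ofCStarAlgebra G.EdgeSum) G.nullSpace G.isKernel_nullSpace

/-- The operator system `S_G`, universal for positive operator representations of `G`. -/
noncomputable def S : OperatorSystem G.SSpace :=
  (OperatorSystem.ofCStarAlgebra G.EdgeSum).quotient G.nullSpace G.isKernel_nullSpace

/-- The canonical generators `a_x = |E| [δ_x^e]` of `S_G`. -/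
noncomputable def a (x : V) : G.SSpace :=
  (G.edges.card : ℂ) • OperatorSystem.Quot.mk (OperatorSystem.ofCStarAlgebra G.EdgeSum)
    G.nullSpace G.isKernel_nullSpace (G.delta (G.edgeOf x) ⟨x, G.mem_edgeOf x⟩)

/-- The generator `a_x` does not depend on the choice of a hyperedge containing `x`. -/
theorem a_eq (e : G.Edge) (x : e.Vertex) :
    G.a x.1 = (G.edges.card : ℂ) • OperatorSystem.Quot.mk (OperatorSystem.ofCStarAlgebra G.EdgeSum)
      G.nullSpace G.isKernel_nullSpace (G.delta e x) := by
  rw [a, ← sub_eq_zero, ← smul_sub, ← map_sub,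
    OperatorSystem.Quot.mk_eq_zero.2, smul_zero]
  rw [mem_nullSpace]
  intro p _
  rw [map_sub, pairing_delta, pairing_delta, sub_self]

/-! #### The operator system of quantum models -/

theorem star_p (x : V) : star (CStar.p x : G.CStar) = CStar.p x :=
  (CStar.isStarProjection_p x).isSelfAdjoint

theorem one_mem_span_p : (OperatorSystem.ofCStarAlgebra G.CStar).unit ∈
    Submodule.span ℂ (Set.range (CStar.p : V → G.CStar)) := by
  obtain ⟨e, he⟩ := G.edges_nonempty
  change (1 : G.CStar) ∈ _
  rw [← CStar.sum_p he]
  exact Submodule.sum_mem _ fun x _ => Submodule.subset_span ⟨x, rfl⟩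

/-- The underlying vector space of the operator system `T_G`. -/
abbrev TSpace : Type u := OperatorSystem.SelfAdjSpan (CStar.p : V → G.CStar) G.star_p

/-- The operator system `T_G = span {p_x : x ∈ V}`, an operator subsystem of `C*(G)`. -/
noncomputable def T : OperatorSystem G.TSpace :=
  (OperatorSystem.ofCStarAlgebra G.CStar).subsystem CStar.p G.star_p G.one_mem_span_p

/-- The canonical generators `p_x` of `T_G`. -/
noncomputable def p (x : V) : G.TSpace := OperatorSystem.SelfAdjSpan.gen CStar.p G.star_p x

/-! #### The operator system of classical models -/

/-- Points of the product `∏_{e ∈ E} e`. -/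
abbrev Selection : Type u := ∀ e : G.Edge, e.Vertex

/-- The C*-algebra `⊗_{e ∈ E} ℓ^∞_e = C(∏_{e ∈ E} e)`. -/
abbrev EdgeTensor : Type u := G.Selection → ℂ

/-- The elementary tensor with `δ_x^e` in the factor `ℓ^∞_e` and `1` elsewhere, as a function on
`∏_{e ∈ E} e`. -/
noncomputable def tensorDelta (e : G.Edge) (x : e.Vertex) : G.EdgeTensor := fun ω => by
  classical exact if ω e = x then 1 else 0

/-- The ideal of `⊗_{e ∈ E} ℓ^∞_e` that identifies `δ_x^e` with `δ_x^f` for `x ∈ e ∩ f`. -/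
def tensorIdeal : Ideal G.EdgeTensor :=
  Ideal.span {g | ∃ (e f : G.Edge) (x : V) (he : x ∈ e.1) (hf : x ∈ f.1),
    g = G.tensorDelta e ⟨x, he⟩ - G.tensorDelta f ⟨x, hf⟩}

/-- The points of `∏_{e ∈ E} e` at which all elements of `tensorIdeal` vanish. -/
def zeroLocus : Set G.Selection := {ω | ∀ g ∈ G.tensorIdeal, g ω = 0}

theorem mem_tensorIdeal (g : G.EdgeTensor) :
    g ∈ G.tensorIdeal ↔ ∀ ω ∈ G.zeroLocus, g ω = 0 := by
  classical
  refine ⟨fun hg ω hω => hω g hg, fun h => ?_⟩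
  have : Finite G.Selection := inferInstance
  have := Fintype.ofFinite G.Selection
  have hsum : g = ∑ ω, g ω • (Pi.single ω 1 : G.EdgeTensor) := by
    ext η
    rw [Finset.sum_apply, Finset.sum_eq_single η]
    · simp
    · intro ω _ hω
      simp [Ne.symm hω]
    · simp
  rw [hsum]
  refine Ideal.sum_mem _ fun ω _ => ?_
  by_cases hω : ω ∈ G.zeroLocus
  · rw [h ω hω, zero_smul]
    exact Ideal.zero_mem _
  · have hω' : ∃ k ∈ G.tensorIdeal, k ω ≠ 0 := by
      by_contra hcon
      push Not at hcon
      exact hω hcon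
    obtain ⟨k, hk, hkω⟩ := hω'
    have e : g ω • (Pi.single ω 1 : G.EdgeTensor) = Pi.single ω (g ω * (k ω)⁻¹) * k := by
      ext η
      by_cases hη : η = ω
      · subst hη
        simp [hkω]
      · simp [hη]
    rw [e]
    exact Ideal.mul_mem_left _ _ hk

theorem tensorIdeal_le_comap_star :
    G.tensorIdeal ≤ G.tensorIdeal.comap (starRingEnd G.EdgeTensor) := by
  intro g hg
  rw [Ideal.mem_comap, mem_tensorIdeal]
  intro ω hω
  change star (g ω) = 0
  rw [hω g hg, star_zero]

/-- The abelian C*-algebra `D_G`, the quotient of `⊗_{e ∈ E} ℓ^∞_e` by `tensorIdeal`. -/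
def ClassicalCStar : Type u := G.EdgeTensor ⧸ G.tensorIdeal

namespace ClassicalCStar

noncomputable instance instCommRing : CommRing G.ClassicalCStar :=
  inferInstanceAs (CommRing (G.EdgeTensor ⧸ G.tensorIdeal))
noncomputable instance instAlgebra : Algebra ℂ G.ClassicalCStar :=
  inferInstanceAs (Algebra ℂ (G.EdgeTensor ⧸ G.tensorIdeal))

/-- The quotient map. -/
noncomputable def mk : G.EdgeTensor →ₐ[ℂ] G.ClassicalCStar := Ideal.Quotient.mkₐ ℂ G.tensorIdeal

theorem mk_surjective : Function.Surjective (mk G) := Ideal.Quotient.mk_surjective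

theorem mk_eq_zero {g : G.EdgeTensor} : mk G g = 0 ↔ g ∈ G.tensorIdeal :=
  Ideal.Quotient.eq_zero_iff_mem

noncomputable instance : Star G.ClassicalCStar :=
  ⟨Ideal.quotientMap G.tensorIdeal (starRingEnd G.EdgeTensor) G.tensorIdeal_le_comap_star⟩

theorem star_mk (g : G.EdgeTensor) : star (mk G g) = mk G (star g) := rfl

noncomputable instance : StarRing G.ClassicalCStar where
  star_involutive s := by
    obtain ⟨s, rfl⟩ := mk_surjective G s
    rw [star_mk, star_mk, star_star]
  star_mul s t := by
    obtain ⟨s, rfl⟩ := mk_surjective G s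
    obtain ⟨t, rfl⟩ := mk_surjective G t
    rw [← map_mul, star_mk, star_mk, star_mk, star_mul, map_mul]
  star_add s t := by
    obtain ⟨s, rfl⟩ := mk_surjective G s
    obtain ⟨t, rfl⟩ := mk_surjective G t
    rw [← map_add, star_mk, star_mk, star_mk, star_add, map_add]

instance : Finite G.zeroLocus := inferInstance

noncomputable instance : Fintype G.zeroLocus := Fintype.ofFinite _

/-- Restriction of functions to the zero locus of the ideal. -/
noncomputable def restr : G.ClassicalCStar →ₐ[ℂ] (G.zeroLocus → ℂ) :=
  Ideal.Quotient.liftₐ G.tensorIdeal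
    (AlgHom.pi fun ω : G.zeroLocus => Pi.evalAlgHom ℂ (fun _ : G.Selection => ℂ) ω.1)
    fun g hg => funext fun ω => ω.2 g hg

theorem restr_mk (g : G.EdgeTensor) (ω : G.zeroLocus) : restr G (mk G g) ω = g ω.1 := rfl

theorem restr_injective : Function.Injective (restr G) := by
  rw [injective_iff_map_eq_zero]
  intro s hs
  obtain ⟨g, rfl⟩ := mk_surjective G s
  rw [mk_eq_zero, mem_tensorIdeal]
  intro ω hω
  exact congrFun hs ⟨ω, hω⟩

theorem restr_star (s : G.ClassicalCStar) : restr G (star s) = star (restr G s) := by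
  obtain ⟨g, rfl⟩ := mk_surjective G s
  rfl

/-- The norm of `D_G` is the supremum norm on the zero locus, which is the unique C*-norm. -/
noncomputable instance : NormedCommRing G.ClassicalCStar :=
  { NormedCommRing.induced G.ClassicalCStar (G.zeroLocus → ℂ) (restr G) (restr_injective G) with
    toCommRing := instCommRing G }

theorem norm_eq (s : G.ClassicalCStar) : ‖s‖ = ‖restr G s‖ := rfl

noncomputable instance : NormedAlgebra ℂ G.ClassicalCStar where
  norm_smul_le z s := by
    rw [norm_eq, norm_eq, map_smul]
    exact norm_smul_le z _

instance : FiniteDimensional ℂ G.ClassicalCStar :=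
  Module.Finite.of_injective (restr G).toLinearMap (restr_injective G)

noncomputable instance : CStarAlgebra G.ClassicalCStar where
  toCompleteSpace := FiniteDimensional.complete ℂ _
  norm_mul_self_le s := by
    rw [norm_eq, norm_eq, map_mul, restr_star]
    exact CStarRing.norm_mul_self_le _
  star_smul z s := by
    obtain ⟨s, rfl⟩ := mk_surjective G s
    rw [← map_smul, star_mk, star_mk, star_smul, map_smul]

/-- The canonical projections `d_x`. -/
noncomputable def d (x : V) : G.ClassicalCStar :=
  mk G (G.tensorDelta (G.edgeOf x) ⟨x, G.mem_edgeOf x⟩)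

/-- The projection `d_x` does not depend on the choice of a hyperedge containing `x`. -/
theorem d_eq (e : G.Edge) (x : e.Vertex) : d G x.1 = mk G (G.tensorDelta e x) := by
  rw [d, ← sub_eq_zero, ← map_sub, mk_eq_zero]
  exact Ideal.subset_span ⟨_, _, x.1, _, _, rfl⟩

theorem star_d (x : V) : star (d G x) = d G x := by
  rw [d, star_mk]
  congr 1
  ext ω
  simp only [Pi.star_apply, tensorDelta, apply_ite star, star_one, star_zero]

theorem sum_d (e : G.Edge) : ∑ x : e.Vertex, d G x.1 = 1 := by
  simp only [d_eq]
  rw [← map_sum, ← map_one (mk G)]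
  congr 1
  ext ω
  rw [Finset.sum_apply, Finset.sum_eq_single (ω e)]
  · simp [tensorDelta]
  · intro y _ hy
    simp [tensorDelta, Ne.symm hy]
  · simp

end ClassicalCStar

theorem one_mem_span_d : (OperatorSystem.ofCStarAlgebra G.ClassicalCStar).unit ∈
    Submodule.span ℂ (Set.range (ClassicalCStar.d G)) := by
  obtain ⟨e, he⟩ := G.edges_nonempty
  change (1 : G.ClassicalCStar) ∈ _
  rw [← ClassicalCStar.sum_d G ⟨e, he⟩]
  exact Submodule.sum_mem _ fun x _ => Submodule.subset_span ⟨x.1, rfl⟩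

/-- The underlying vector space of the operator system `R_G`. -/
abbrev RSpace : Type u := OperatorSystem.SelfAdjSpan (ClassicalCStar.d G) (ClassicalCStar.star_d G)

/-- The operator system `R_G = span {d_x : x ∈ V}`, an operator subsystem of `D_G`. -/
noncomputable def R : OperatorSystem G.RSpace :=
  (OperatorSystem.ofCStarAlgebra G.ClassicalCStar).subsystem (ClassicalCStar.d G)
    (ClassicalCStar.star_d G) G.one_mem_span_d

/-- The canonical generators `d_x` of `R_G`. -/
noncomputable def d (x : V) : G.RSpace :=
  OperatorSystem.SelfAdjSpan.gen (ClassicalCStar.d G) (ClassicalCStar.star_d G) x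

end ContextualityScenario

/-!
An operator system of the form `OMIN(W)` is determined by its positive cone, hence, by
Hahn–Banach, by the states of `W`. A state of `W` is determined by its real values on a spanning
family of self-adjoint elements, so two systems `OMIN(W)` and `OMIN(W')` agree canonically if and
only if the states of `W` and of `W'` take the same values on the generators.

On the generators `a_x` of `S_G`, `p_x` of `T_G` and `d_x` of `R_G`, the states take exactly the
values of the general, the quantum and the classical models: a state of `S_G` is a normalised
pairing with a model; a state of `T_G` extends to `C*(G)`, where the GNS construction makes it a
vector state; and `D_G` is the algebra of functions on the finite set of deterministic models, so
that its states are the convex combinations of evaluations. As `R_G` lies in an abelian C*-algebra,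
`OMIN(R_G) = R_G`.
-/

section OrderUnit

variable {E : Type*} [AddCommGroup E] [Module ℝ E] (K : PointedCone ℝ E) {u : E}

theorem exists_dual_nonneg_of_neg_unit_notMem (hu : ∀ x, ∃ r : ℝ, r • u + x ∈ K) (hneg : -u ∉ K) :
    ∃ g : E →ₗ[ℝ] ℝ, g u = 1 ∧ ∀ x ∈ K, 0 ≤ g x := by
  have hu0 : u ≠ 0 := by
    rintro rfl
    exact hneg (by simp)
  have nonneg_of_smul_mem (c : ℝ) (hc : c • u ∈ K) : 0 ≤ c := by
    by_contra! hlt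
    refine hneg ((K.smul_mem_iff (neg_pos.2 hlt)).1 ?_)
    rwa [smul_neg, neg_smul, neg_neg]
  obtain ⟨g, hg, hgK⟩ := riesz_extension K (LinearPMap.mkSpanSingleton u (1 : ℝ) hu0) (by
    rintro ⟨x, hx⟩ hxK
    obtain ⟨c, rfl⟩ := Submodule.mem_span_singleton.1 hx
    rw [LinearPMap.mkSpanSingleton'_apply]
    simpa using nonneg_of_smul_mem c hxK) fun x => by
      obtain ⟨r, hr⟩ := hu x
      exact ⟨⟨r • u, Submodule.mem_span_singleton.2 ⟨r, rfl⟩⟩, hr⟩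
  refine ⟨g, (hg ⟨u, Submodule.mem_span_singleton_self u⟩).trans ?_, hgK⟩
  exact LinearPMap.mkSpanSingleton'_apply_self ..

theorem neg_unit_notMem_sup_hull_neg (hu : ∀ x, ∃ r : ℝ, 0 < r ∧ r • u + x ∈ K) {t : E}
    (ht : t ∉ K) : -u ∉ K ⊔ PointedCone.hull ℝ {-t} := by
  intro h
  obtain ⟨c, hc, d, hd, hcd⟩ := Submodule.mem_sup.1 h
  obtain ⟨⟨a, ha⟩, rfl⟩ := Submodule.mem_span_singleton.1 hd
  replace hcd : a • t = u + c := by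
    rw [Nonneg.mk_smul, smul_neg, ← sub_eq_add_neg, sub_eq_iff_eq_add] at hcd
    rw [hcd, neg_add_eq_sub, add_sub_cancel]
  obtain ⟨k, hk, hkt⟩ := hu t
  have hpos : 0 < 1 + k * a := by positivity
  refine ht ((K.smul_mem_iff hpos).1 ?_)
  convert K.add_mem hkt (K.smul_mem hk.le hc) using 1
  rw [add_smul, mul_smul, hcd]
  module

end OrderUnit

theorem exists_linearEquiv_of_linearCombination_eq_zero_iff {ι R M N : Type*} [Ring R]
    [AddCommGroup M] [Module R M] [AddCommGroup N] [Module R N] {v : ι → M} {w : ι → N}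
    (hv : Submodule.span R (Set.range v) = ⊤) (hw : Submodule.span R (Set.range w) = ⊤)
    (h : ∀ c, Finsupp.linearCombination R v c = 0 ↔ Finsupp.linearCombination R w c = 0) :
    ∃ φ : M ≃ₗ[R] N, ∀ i, φ (v i) = w i := by
  let e := (Finsupp.linearCombination R v).quotKerEquivOfSurjective
    (LinearMap.range_eq_top.1 ((Finsupp.range_linearCombination R).trans hv))
  let e' := (Finsupp.linearCombination R w).quotKerEquivOfSurjective
    (LinearMap.range_eq_top.1 ((Finsupp.range_linearCombination R).trans hw))
  have hker : LinearMap.ker (Finsupp.linearCombination R v) =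
      LinearMap.ker (Finsupp.linearCombination R w) := Submodule.ext h
  refine ⟨e.symm ≪≫ₗ Submodule.quotEquivOfEq _ _ hker ≪≫ₗ e', fun i => ?_⟩
  have hi : e (Submodule.Quotient.mk (Finsupp.single i 1)) = v i := by simp [e]
  simp [← hi, e']

namespace OperatorSystem

variable {S T : Type*} [AddCommGroup S] [Module ℂ S] [StarAddMonoid S] [StarModule ℂ S]
  [AddCommGroup T] [Module ℂ T] [StarAddMonoid T] [StarModule ℂ T]

section States

variable (X : OperatorSystem S)

/-- The positive cone of an operator system, as a cone in the real vector space of self-adjoint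
elements. -/
def selfAdjointCone : PointedCone ℝ (selfAdjoint S) where
  carrier := {s | (s : S) ∈ X.toAOUSpace.cone}
  add_mem' hs ht := X.toAOUSpace.add_mem _ hs _ ht
  zero_mem' := X.toAOUSpace.zero_mem
  smul_mem' r _ hs := X.toAOUSpace.smul_mem r.1 r.2 _ hs

/-- The order unit of an operator system, as a self-adjoint element. -/
def selfAdjointUnit : selfAdjoint S := ⟨X.unit, X.star_unit⟩

theorem exists_smul_selfAdjointUnit_add_mem (s : selfAdjoint S) :
    ∃ r : ℝ, 0 < r ∧ r • X.selfAdjointUnit + s ∈ X.selfAdjointCone :=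
  X.toAOUSpace.orderUnit s s.2

theorem exists_isState_nonneg_on (K : PointedCone ℝ (selfAdjoint S)) (hK : X.selfAdjointCone ≤ K)
    (hunit : -X.selfAdjointUnit ∉ K) : ∃ f, X.IsState f ∧ ∀ s ∈ K, 0 ≤ f s := by
  obtain ⟨g, hg1, hgK⟩ := exists_dual_nonneg_of_neg_unit_notMem K (fun s => by
    obtain ⟨r, -, hr⟩ := X.exists_smul_selfAdjointUnit_add_mem s
    exact ⟨r, hK hr⟩) hunit
  let f : S →ₗ[ℂ] ℂ := Module.Dual.extendRCLike (g ∘ₗ realPart)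
  have hf (s : selfAdjoint S) : f s = g s := by
    simp [f, Module.Dual.extendRCLike_apply]
  have hf_nonneg (s : selfAdjoint S) (hs : s ∈ K) : 0 ≤ f s := by
    rw [hf]
    exact Complex.zero_le_real.2 (hgK s hs)
  refine ⟨f, ⟨?_, fun s hs => ?_⟩, hf_nonneg⟩
  · rw [show X.unit = X.selfAdjointUnit from rfl, hf, hg1, Complex.ofReal_one]
  · exact hf_nonneg ⟨s, X.toAOUSpace.star_eq s hs⟩ (hK hs)

variable {X}

theorem IsState.map_smul_unit_add {f : S →ₗ[ℂ] ℂ} (hf : X.IsState f) (z : ℂ) (s : S) :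
    f (z • X.unit + s) = z + f s := by
  rw [map_add, map_smul, hf.1, smul_eq_mul, mul_one]

theorem exists_isState_nonpos {t : selfAdjoint S} (ht : (t : S) ∉ X.toAOUSpace.cone) :
    ∃ f, X.IsState f ∧ f t ≤ 0 := by
  obtain ⟨f, hf, hfK⟩ := X.exists_isState_nonneg_on (X.selfAdjointCone ⊔ PointedCone.hull ℝ {-t})
    le_sup_left
    (neg_unit_notMem_sup_hull_neg _ X.exists_smul_selfAdjointUnit_add_mem ht)
  have hft := hfK (-t) (Submodule.mem_sup_right (Submodule.mem_span_singleton_self _))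
  rw [NegMemClass.coe_neg, map_neg, neg_nonneg] at hft
  exact ⟨f, hf, hft⟩

theorem mem_cone_of_isSelfAdjoint {s : S} (hs : IsSelfAdjoint s)
    (h : ∀ f, X.IsState f → 0 ≤ f s) : s ∈ X.toAOUSpace.cone := by
  refine X.toAOUSpace.archimedean s hs fun r hr => ?_
  by_contra hmem
  obtain ⟨f, hf, hneg⟩ := exists_isState_nonpos (t := r • X.selfAdjointUnit + ⟨s, hs⟩) hmem
  have hf_eq : f ((r • X.selfAdjointUnit + ⟨s, hs⟩ : selfAdjoint S) : S) = r + f s :=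
    hf.map_smul_unit_add r s
  rw [hf_eq] at hneg
  exact (add_pos_of_pos_of_nonneg (Complex.zero_lt_real.2 hr) (h f hf)).not_ge hneg

theorem eq_zero_of_forall_isState {s : S} (h : ∀ f, X.IsState f → f s = 0) : s = 0 := by
  have eq_zero_of_isSelfAdjoint (t : selfAdjoint S) (ht : ∀ f, X.IsState f → f t = 0) :
      (t : S) = 0 := by
    refine X.toAOUSpace.proper _ (mem_cone_of_isSelfAdjoint t.2 fun f hf => (ht f hf).ge)
      (mem_cone_of_isSelfAdjoint (IsSelfAdjoint.neg t.2) fun f hf => ?_)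
    rw [map_neg, ht f hf, neg_zero]
  have hstar (f : S →ₗ[ℂ] ℂ) (hf : X.IsState f) : f (star s) = 0 := by
    rw [hf.map_star, h f hf, star_zero]
  rw [← realPart_add_I_smul_imaginaryPart s, eq_zero_of_isSelfAdjoint (realPart s),
    eq_zero_of_isSelfAdjoint (imaginaryPart s), smul_zero, add_zero]
  · intro f hf
    rw [imaginaryPart_apply_coe, map_smul, LinearMap.map_smul_of_tower, map_sub, h f hf,
      hstar f hf, sub_zero, smul_zero, smul_zero]
  · intro f hf
    rw [realPart_apply_coe, LinearMap.map_smul_of_tower, map_add, h f hf, hstar f hf, add_zero,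
      smul_zero]

theorem mem_cone_iff_forall_isState {s : S} :
    s ∈ X.toAOUSpace.cone ↔ ∀ f, X.IsState f → 0 ≤ f s := by
  refine ⟨fun hs f hf => hf.2 s hs, fun h => mem_cone_of_isSelfAdjoint ?_ h⟩
  refine sub_eq_zero.1 (eq_zero_of_forall_isState (X := X) fun f hf => ?_)
  rw [map_sub, hf.map_star, (IsSelfAdjoint.of_nonneg (h f hf)).star_eq, sub_self]

theorem ext_of_eqOn_selfAdjoint {f g : S →ₗ[ℂ] ℂ} (h : ∀ s, IsSelfAdjoint s → f s = g s) :
    f = g := by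
  ext s
  rw [← realPart_add_I_smul_imaginaryPart s, map_add, map_add, map_smul, map_smul,
    h _ (realPart s).2, h _ (imaginaryPart s).2]

/-- The cone `Y⁺ + φ {s | 0 ≤ f s}` of self-adjoint elements. A state that is non-negative on it
extends `f` along `φ`. -/
def extensionCone (Y : OperatorSystem T) (φ : S →ₗ[ℂ] T) (f : S →ₗ[ℂ] ℂ) :
    PointedCone ℝ (selfAdjoint T) where
  carrier := {t | ∃ c ∈ Y.toAOUSpace.cone, ∃ s, 0 ≤ f s ∧ (t : T) = c + φ s}
  add_mem' := by
    rintro _ _ ⟨c, hc, s, hs, ht⟩ ⟨c', hc', s', hs', ht'⟩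
    refine ⟨c + c', Y.toAOUSpace.add_mem _ hc _ hc', s + s', ?_, ?_⟩
    · rw [map_add]
      exact add_nonneg hs hs'
    · rw [AddSubgroup.coe_add, ht, ht', map_add, add_add_add_comm]
  zero_mem' := ⟨0, Y.toAOUSpace.zero_mem, 0, by simp, by simp⟩
  smul_mem' := by
    rintro ⟨r, hr⟩ t ⟨c, hc, s, hs, ht⟩
    refine ⟨_, Y.toAOUSpace.smul_mem r hr c hc, (r : ℂ) • s, ?_, ?_⟩
    · rw [map_smul]
      exact mul_nonneg (Complex.zero_le_real.2 hr) hs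
    · rw [Nonneg.mk_smul, selfAdjoint.val_smul, ht, map_smul, ← smul_add, Complex.coe_smul]

theorem neg_unit_notMem_extensionCone {Y : OperatorSystem T} {φ : S →ₗ[ℂ] T}
    (hunit : φ X.unit = Y.unit) (hcone : ∀ s, φ s ∈ Y.toAOUSpace.cone → s ∈ X.toAOUSpace.cone)
    {f : S →ₗ[ℂ] ℂ} (hf : X.IsState f) : -Y.selfAdjointUnit ∉ Y.extensionCone φ f := by
  rintro ⟨c, hc, s, hs, hcs⟩
  have hmem : (-1 : ℂ) • X.unit + -s ∈ X.toAOUSpace.cone := hcone _ (by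
    rw [map_add, map_smul, map_neg, hunit, neg_one_smul, ← sub_eq_add_neg]
    rwa [sub_eq_of_eq_add (a := -Y.unit) hcs])
  have hle := hf.2 _ hmem
  rw [hf.map_smul_unit_add, map_neg, ← neg_add, neg_nonneg] at hle
  exact (add_pos_of_pos_of_nonneg zero_lt_one hs).not_ge hle

theorem IsState.exists_comp_eq {Y : OperatorSystem T} {φ : S →ₗ[ℂ] T}
    (hstar : ∀ s, φ (star s) = star (φ s)) (hunit : φ X.unit = Y.unit)
    (hcone : ∀ s, φ s ∈ Y.toAOUSpace.cone → s ∈ X.toAOUSpace.cone) {f : S →ₗ[ℂ] ℂ}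
    (hf : X.IsState f) : ∃ g, Y.IsState g ∧ g ∘ₗ φ = f := by
  obtain ⟨g, hg, hgK⟩ := Y.exists_isState_nonneg_on (Y.extensionCone φ f)
    (fun t ht => ⟨t, ht, 0, by simp, by simp⟩) (neg_unit_notMem_extensionCone hunit hcone hf)
  have nonneg_of_nonneg {s : S} (hs : IsSelfAdjoint s) (hfs : 0 ≤ f s) : 0 ≤ g (φ s) :=
    hgK ⟨φ s, (hstar s).symm.trans (congrArg φ hs)⟩
      ⟨0, Y.toAOUSpace.zero_mem, s, hfs, (zero_add _).symm⟩
  refine ⟨g, hg, ext_of_eqOn_selfAdjoint fun s hs => ?_⟩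
  -- Since `f u = 0`, both `φ u` and `-φ u` lie in the cone on which `g` is non-negative.
  set u : S := (-f s) • X.unit + s with hu
  have hfu : f u = 0 := by rw [hf.map_smul_unit_add, neg_add_cancel]
  have hfs : star (f s) = f s := by rw [← hf.map_star, hs.star_eq]
  have hu_star : IsSelfAdjoint u := by
    rw [IsSelfAdjoint, star_add, star_smul, X.star_unit, hs.star_eq, star_neg, hfs]
  have hneg : 0 ≤ g (φ (-u)) := nonneg_of_nonneg hu_star.neg (by rw [map_neg, hfu, neg_zero])
  rw [map_neg, map_neg, neg_nonneg] at hneg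
  have hgu : g (φ u) = 0 := hneg.antisymm (nonneg_of_nonneg hu_star hfu.ge)
  rwa [hu, map_add, map_smul, hunit, hg.map_smul_unit_add, neg_add_eq_zero, eq_comm] at hgu

end States

section StateModels

variable {V : Type*}

/-- The real-valued functions that the states of `X` induce on a family `w` of elements. -/
def stateModels (X : OperatorSystem S) (w : V → S) : Set (V → ℝ) :=
  {p | ∃ f, X.IsState f ∧ ∀ x, f (w x) = p x}

theorem convex_stateModels (X : OperatorSystem S) (w : V → S) :
    Convex ℝ (X.stateModels w) := by
  rintro p ⟨f, hf, hfp⟩ q ⟨g, hg, hgq⟩ r s hr hs hrs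
  refine ⟨(r : ℂ) • f + (s : ℂ) • g, ⟨?_, fun t ht => ?_⟩, fun x => ?_⟩
  · simpa [hf.1, hg.1] using congrArg Complex.ofReal hrs
  · exact add_nonneg (mul_nonneg (Complex.zero_le_real.2 hr) (hf.2 t ht))
      (mul_nonneg (Complex.zero_le_real.2 hs) (hg.2 t ht))
  · simp [hfp, hgq]

theorem stateModels_subsystem (X : OperatorSystem S) {b : V → S} (hb : ∀ x, star (b x) = b x)
    (h1 : X.unit ∈ Submodule.span ℂ (Set.range b)) :
    (X.subsystem b hb h1).stateModels (SelfAdjSpan.gen b hb) = X.stateModels b := by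
  ext p
  constructor
  · rintro ⟨f, hf, hfp⟩
    obtain ⟨g, hg, rfl⟩ := hf.exists_comp_eq (Y := X) (φ := SelfAdjSpan.incl b hb)
      SelfAdjSpan.incl_star rfl fun _ hs => hs
    exact ⟨g, hg, hfp⟩
  · rintro ⟨g, hg, hgp⟩
    exact ⟨g ∘ₗ SelfAdjSpan.incl b hb, ⟨hg.1, fun s hs => hg.2 _ hs⟩, hgp⟩

/-- A family of self-adjoint elements with full linear span. -/
structure IsSelfAdjointSpanning (w : V → S) : Prop where
  star_eq : ∀ x, star (w x) = w x
  span_eq_top : Submodule.span ℂ (Set.range w) = ⊤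

theorem SelfAdjSpan.isSelfAdjointSpanning_gen {b : V → S} (hb : ∀ x, star (b x) = b x) :
    IsSelfAdjointSpanning (SelfAdjSpan.gen b hb) where
  star_eq x := Subtype.ext (hb x)
  span_eq_top := by
    refine Submodule.map_injective_of_injective (f := incl b hb) incl_injective ?_
    rw [Submodule.map_span, ← Set.range_comp, Submodule.map_top]
    exact (Submodule.range_subtype _).symm

variable {X : OperatorSystem S} {Y : OperatorSystem T} {w : V → S} {w' : V → T}

theorem IsState.exists_mem_stateModels {f : S →ₗ[ℂ] ℂ} (hf : X.IsState f)
    (hw : ∀ x, star (w x) = w x) : ∃ p ∈ X.stateModels w, ∀ x, f (w x) = p x := by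
  have hp (x : V) : f (w x) = ((f (w x)).re : ℂ) :=
    (Complex.conj_eq_iff_re.1 (by rw [starRingEnd_apply, ← hf.map_star, hw])).symm
  exact ⟨_, ⟨f, hf, hp⟩, hp⟩

theorem linearCombination_eq_zero_of_stateModels_subset (hw' : ∀ x, star (w' x) = w' x)
    (h : Y.stateModels w' ⊆ X.stateModels w) {c : V →₀ ℂ}
    (hc : Finsupp.linearCombination ℂ w c = 0) : Finsupp.linearCombination ℂ w' c = 0 := by
  refine eq_zero_of_forall_isState (X := Y) fun f hf => ?_
  obtain ⟨p, hp, hfp⟩ := hf.exists_mem_stateModels hw'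
  obtain ⟨g, -, hgp⟩ := h hp
  have hfg : f ∘ w' = g ∘ w := funext fun x => (hfp x).trans (hgp x).symm
  rw [Finsupp.apply_linearCombination, hfg, ← Finsupp.apply_linearCombination, hc, map_zero]

theorem IsState.of_stateModels_subset (hw : ∀ x, star (w x) = w x)
    (hw' : Submodule.span ℂ (Set.range w') = ⊤) (h : X.stateModels w ⊆ Y.stateModels w')
    {f : S →ₗ[ℂ] ℂ} {g : T →ₗ[ℂ] ℂ} (hf : X.IsState f) (hgf : ∀ x, g (w' x) = f (w x)) :
    Y.IsState g := by
  obtain ⟨p, hp, hfp⟩ := hf.exists_mem_stateModels hw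
  obtain ⟨g', hg', hgp'⟩ := h hp
  have : g = g' := LinearMap.ext_on_range hw' fun x => by rw [hgf, hfp, hgp']
  rwa [this]

end StateModels

section OMIN

variable (X : OperatorSystem S) (Y : OperatorSystem T)

theorem cone_OMIN : X.OMIN.toAOUSpace.cone = X.toAOUSpace.cone := by
  ext s
  change (∀ l, quad (single s) l ∈ X.toAOUSpace.cone) ↔ _
  simp only [← single_diag, quad_diag]
  refine ⟨fun h => ?_, fun hs l => X.toAOUSpace.smul_mem _ (by positivity) s hs⟩
  simpa using h 1

variable {X Y}

theorem isUnitalCompleteOrderIso_OMIN_iff {φ : S ≃ₗ[ℂ] T} :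
    IsUnitalCompleteOrderIso X.OMIN Y.OMIN φ ↔
      φ X.unit = Y.unit ∧ ∀ s, φ s ∈ Y.toAOUSpace.cone ↔ s ∈ X.toAOUSpace.cone := by
  constructor
  · rintro ⟨hunit, hφ, hφ'⟩
    refine ⟨hunit, fun s => ⟨fun hs => ?_, fun hs => ?_⟩⟩
    · rw [← cone_OMIN] at hs ⊢
      have : (single (φ s)).map φ.symm ∈ X.OMIN.pos 1 := hφ' 1 _ hs
      rwa [← φ.symm_apply_apply s]
    · rw [← cone_OMIN] at hs ⊢
      exact hφ 1 _ hs
  · rintro ⟨hunit, hφ⟩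
    refine ⟨hunit, isCompletelyPositive_OMIN _ _ _ fun s hs => ?_,
      isCompletelyPositive_OMIN _ _ _ fun s hs => ?_⟩
    · rw [cone_OMIN] at hs
      exact (hφ s).2 hs
    · rw [cone_OMIN] at hs
      exact (hφ _).1 (by simpa using hs)

theorem isUnitalCompleteOrderIso_OMIN_iff_isState {φ : S ≃ₗ[ℂ] T} :
    IsUnitalCompleteOrderIso X.OMIN Y.OMIN φ ↔
      ∀ f, Y.IsState f ↔ X.IsState (f ∘ₗ φ.toLinearMap) := by
  rw [isUnitalCompleteOrderIso_OMIN_iff]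
  constructor
  · rintro ⟨hunit, hφ⟩ f
    simp only [IsState, LinearMap.comp_apply, LinearEquiv.coe_coe, hunit, ← hφ, φ.surjective.forall]
  · intro h
    refine ⟨sub_eq_zero.1 (eq_zero_of_forall_isState (X := Y) fun f hf => ?_), fun s => ?_⟩
    · have : f (φ X.unit) = 1 := ((h f).1 hf).1
      rw [map_sub, this, hf.1, sub_self]
    · rw [mem_cone_iff_forall_isState, mem_cone_iff_forall_isState]
      refine ⟨fun hs g hg => ?_, fun hs f hf => hs _ ((h f).1 hf)⟩
      have hcomp : (g ∘ₗ φ.symm.toLinearMap) ∘ₗ φ.toLinearMap = g := by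
        ext t
        simp
      simpa using hs (g ∘ₗ φ.symm.toLinearMap) ((h _).2 (by rwa [hcomp]))

theorem canonicallyEq_OMIN_iff {V : Type*} {w : V → S} {w' : V → T}
    (hw : IsSelfAdjointSpanning w) (hw' : IsSelfAdjointSpanning w') :
    CanonicallyEq X.OMIN Y.OMIN w w' ↔ X.stateModels w = Y.stateModels w' := by
  constructor
  · rintro ⟨φ, hφ, hiso⟩
    rw [isUnitalCompleteOrderIso_OMIN_iff_isState] at hiso
    have hiso' (f : S →ₗ[ℂ] ℂ) : Y.IsState (f ∘ₗ φ.symm.toLinearMap) ↔ X.IsState f := by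
      rw [hiso]
      simp [LinearMap.comp_assoc]
    ext p
    constructor
    · rintro ⟨f, hf, hfp⟩
      exact ⟨f ∘ₗ φ.symm.toLinearMap, (hiso' f).2 hf, fun x => by simp [← hφ, hfp]⟩
    · rintro ⟨f, hf, hfp⟩
      exact ⟨f ∘ₗ φ.toLinearMap, (hiso f).1 hf, fun x => by simp [hφ, hfp]⟩
  · intro h
    obtain ⟨φ, hφ⟩ := exists_linearEquiv_of_linearCombination_eq_zero_iff hw.span_eq_top
      hw'.span_eq_top fun c =>
        ⟨linearCombination_eq_zero_of_stateModels_subset hw'.star_eq h.ge,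
          linearCombination_eq_zero_of_stateModels_subset hw.star_eq h.le⟩
    refine ⟨φ, hφ, isUnitalCompleteOrderIso_OMIN_iff_isState.2 fun f =>
      ⟨fun hf => ?_, fun hf => ?_⟩⟩
    · exact hf.of_stateModels_subset hw'.star_eq hw.span_eq_top h.ge fun x => by simp [hφ]
    · exact hf.of_stateModels_subset hw.star_eq hw'.span_eq_top h.le fun x => by simp [hφ]

theorem quad_mem_cone {n : ℕ} {a : Matrix (Fin n) (Fin n) S} (ha : a ∈ X.pos n) (l : Fin n → ℂ) :
    quad a l ∈ X.toAOUSpace.cone := by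
  have h := X.compress_mem n 1 (Matrix.of fun i _ => l i) a ha
  rwa [compress_col] at h

theorem OMIN_eq_self (h : ∀ n, ∀ a : Matrix (Fin n) (Fin n) S,
    (∀ l, quad a l ∈ X.toAOUSpace.cone) → a ∈ X.pos n) : X.OMIN = X := by
  have hpos : X.OMIN.pos = X.pos :=
    funext fun n => Set.Subset.antisymm (h n) fun _ => quad_mem_cone
  have hunit : X.OMIN.unit = X.unit := rfl
  cases hX : X.OMIN
  cases X
  simp_all

theorem OMIN_subsystem (h : X.OMIN = X) {V : Type*} {b : V → S} (hb : ∀ x, star (b x) = b x)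
    (h1 : X.unit ∈ Submodule.span ℂ (Set.range b)) :
    (X.subsystem b hb h1).OMIN = X.subsystem b hb h1 := by
  refine OMIN_eq_self fun n a ha => ?_
  change a.map (SelfAdjSpan.incl b hb) ∈ X.pos n
  rw [← h]
  intro l
  rw [quad_map]
  exact ha l

end OMIN

section Quotient

variable {X : OperatorSystem S} {J : Submodule ℂ S} {hJ : X.IsKernel J}

theorem exists_lift_of_mem_quotient_cone {s : X.Quot J hJ}
    (hs : s ∈ (X.quotient J hJ).toAOUSpace.cone) {r : ℝ} (hr : 0 < r) :
    ∃ t ∈ X.toAOUSpace.cone, Quot.mk X J hJ t = (r : ℂ) • Quot.mk X J hJ X.unit + s := by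
  obtain ⟨b, hb, h⟩ := hs r hr
  refine ⟨b 0 0, ?_, ?_⟩
  · change single (b 0 0) ∈ X.pos 1
    convert hb
    ext i j
    rw [Subsingleton.elim i 0, Subsingleton.elim j 0]
    rfl
  · simpa [single, diag] using congrFun (congrFun h 0) 0

theorem mk_mem_quotient_cone {s : S} (hs : s ∈ X.toAOUSpace.cone) :
    Quot.mk X J hJ s ∈ (X.quotient J hJ).toAOUSpace.cone := fun r hr => by
  refine ⟨(r : ℂ) • diag 1 X.unit + single s, X.add_mem 1 _ (X.smul_diag_mem 1 hr.le) _ hs, ?_⟩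
  rw [Matrix.map_add _ (map_add _), Matrix.map_smul _ _ (fun _ => map_smul _ _ _), Quot.map_diag]
  rfl

theorem IsState.exists_quotient_lift {f : S →ₗ[ℂ] ℂ} (hf : X.IsState f)
    (hfJ : J ≤ LinearMap.ker f) :
    ∃ g, (X.quotient J hJ).IsState g ∧ ∀ s, g (Quot.mk X J hJ s) = f s := by
  let g : X.Quot J hJ →ₗ[ℂ] ℂ := J.liftQ f hfJ
  have hg (s : S) : g (Quot.mk X J hJ s) = f s := J.liftQ_apply f s
  refine ⟨g, ⟨(hg _).trans hf.1, fun s hs => ?_⟩, hg⟩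
  have hpos (r : ℝ) (hr : 0 < r) : 0 ≤ (r : ℂ) + g s := by
    obtain ⟨t, ht, hts⟩ := exists_lift_of_mem_quotient_cone hs hr
    have h := hf.2 t ht
    rwa [← hg, hts, map_add, map_smul, hg, hf.1, smul_eq_mul, mul_one] at h
  refine Complex.nonneg_iff.2 ⟨le_of_forall_pos_le_add fun r hr => ?_, ?_⟩
  · simpa [add_comm] using (Complex.nonneg_iff.1 (hpos r hr)).1
  · simpa using (Complex.nonneg_iff.1 (hpos 1 one_pos)).2

end Quotient

section CStarAlgebra

variable {A : Type*} [CStarAlgebra A]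

theorem mem_cone_ofCStarAlgebra_iff {a : A} :
    a ∈ (ofCStarAlgebra A).toAOUSpace.cone ↔ ∃ b, a = star b * b := by
  constructor
  · rintro ⟨b, hb⟩
    have h := congrFun (congrFun hb 0) 0
    rw [Matrix.mul_apply] at h
    exact ⟨b 0 0, by simpa [single] using h⟩
  · rintro ⟨b, rfl⟩
    refine ⟨single b, ?_⟩
    ext i j
    simp [Matrix.mul_apply, single]

theorem isState_ofCStarAlgebra_iff {f : A →ₗ[ℂ] ℂ} :
    (ofCStarAlgebra A).IsState f ↔ f 1 = 1 ∧ ∀ b, 0 ≤ f (star b * b) := by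
  simp only [IsState, mem_cone_ofCStarAlgebra_iff, forall_exists_index, forall_eq_apply_imp_iff]
  rfl

theorem isState_starAlgHom (χ : A →⋆ₐ[ℂ] ℂ) :
    (ofCStarAlgebra A).IsState (χ : A →ₐ[ℂ] ℂ).toLinearMap :=
  isState_ofCStarAlgebra_iff.2 ⟨map_one χ, fun b => by
    change 0 ≤ χ (star b * b)
    rw [map_mul, map_star]
    exact star_mul_self_nonneg (χ b)⟩

theorem isState_inner_starAlgHom {H : Type*} [NormedAddCommGroup H] [InnerProductSpace ℂ H]
    [CompleteSpace H] (π : A →⋆ₐ[ℂ] (H →L[ℂ] H)) {ψ : H} (hψ : ‖ψ‖ = 1) :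
    (ofCStarAlgebra A).IsState ((innerSL ℂ ψ).toLinearMap ∘ₗ
      (ContinuousLinearMap.apply ℂ H ψ).toLinearMap ∘ₗ (π : A →ₐ[ℂ] (H →L[ℂ] H)).toLinearMap) := by
  refine isState_ofCStarAlgebra_iff.2 ⟨?_, fun b => ?_⟩
  · simp [inner_self_eq_norm_sq_to_K, hψ]
  · change 0 ≤ inner ℂ ψ (π (star b * b) ψ)
    rw [map_mul, map_star, ContinuousLinearMap.star_eq_adjoint, _root_.mul_apply_eq_comp,
      ContinuousLinearMap.adjoint_inner_right]
    simp [inner_self_eq_norm_sq_to_K]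

theorem IsState.exists_starAlgHom_eq_inner {A : Type u} [CStarAlgebra A] {f : A →ₗ[ℂ] ℂ}
    (hf : (ofCStarAlgebra A).IsState f) :
    ∃ (H : Type u) (_ : NormedAddCommGroup H) (_ : InnerProductSpace ℂ H) (_ : CompleteSpace H)
      (π : A →⋆ₐ[ℂ] (H →L[ℂ] H)) (ψ : H), ‖ψ‖ = 1 ∧ ∀ a, f a = inner ℂ ψ (π a ψ) := by
  obtain ⟨hf1, hf⟩ := isState_ofCStarAlgebra_iff.1 hf
  let _ := CStarAlgebra.spectralOrder A
  have _ := CStarAlgebra.spectralOrderedRing A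
  let g : A →ₚ[ℂ] ℂ := PositiveLinearMap.mk₀ f fun a ha => by
    obtain ⟨b, rfl⟩ := CStarAlgebra.nonneg_iff_eq_star_mul_self.1 ha
    exact hf b
  refine ⟨g.GNS, inferInstance, inferInstance, inferInstance, g.gnsStarAlgHom,
    ((g.toPreGNS 1 : g.PreGNS) : g.GNS), ?_, fun a => ?_⟩
  · have hsq : ((‖g.toPreGNS 1‖ ^ 2 : ℝ) : ℂ) = 1 := by
      have h := g.preGNS_norm_sq (g.toPreGNS 1)
      rw [PositiveLinearMap.ofPreGNS_toPreGNS, star_one, one_mul] at h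
      exact_mod_cast h.trans hf1
    rw [UniformSpace.Completion.norm_coe]
    exact (pow_eq_one_iff_of_nonneg (norm_nonneg _) two_ne_zero).1 (by exact_mod_cast hsq)
  · change f a = inner ℂ ((g.toPreGNS 1 : g.PreGNS) : g.GNS)
      (g.gnsNonUnitalStarAlgHom a ((g.toPreGNS 1 : g.PreGNS) : g.GNS))
    rw [PositiveLinearMap.gnsNonUnitalStarAlgHom_apply_coe, UniformSpace.Completion.inner_coe,
      PositiveLinearMap.preGNS_inner_def]
    simp only [PositiveLinearMap.ofPreGNS_toPreGNS, PositiveLinearMap.leftMulMapPreGNS_apply,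
      star_one, one_mul, mul_one]
    rfl

theorem posSemidef_of_quad_nonneg {n : ℕ} {M : Matrix (Fin n) (Fin n) ℂ}
    (hM : ∀ l, 0 ≤ quad M l) : M.PosSemidef := by
  refine Matrix.posSemidef_iff_dotProduct_mulVec.2 ⟨sub_eq_zero.1 (quad_polar fun l => ?_),
    fun l => ?_⟩
  · rw [sub_eq_add_neg, quad_add, quad_neg, ← star_quad, (IsSelfAdjoint.of_nonneg (hM l)).star_eq,
      add_neg_cancel]
  · convert hM l using 1
    simp only [quad, dotProduct, Matrix.mulVec, Finset.mul_sum, Pi.star_apply, smul_eq_mul]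
    exact Finset.sum_congr rfl fun i _ => Finset.sum_congr rfl fun j _ => by ring

open scoped MatrixOrder Matrix.Norms.L2Operator in
theorem exists_eq_conjTranspose_mul_self {n : ℕ} {M : Matrix (Fin n) (Fin n) ℂ}
    (hM : ∀ l, 0 ≤ quad M l) : ∃ B : Matrix (Fin n) (Fin n) ℂ, M = B.conjTranspose * B :=
  CStarAlgebra.nonneg_iff_eq_star_mul_self.1 (posSemidef_of_quad_nonneg hM).nonneg

variable {Ω : Type*} (e : A ≃⋆ₐ[ℂ] (Ω → ℂ))

theorem nonneg_apply_of_mem_cone {a : A} (ha : a ∈ (ofCStarAlgebra A).toAOUSpace.cone) (ω : Ω) :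
    0 ≤ e a ω := by
  obtain ⟨b, rfl⟩ := mem_cone_ofCStarAlgebra_iff.1 ha
  rw [map_mul, map_star]
  exact star_mul_self_nonneg (e b ω)

include e in
theorem OMIN_ofCStarAlgebra : (ofCStarAlgebra A).OMIN = ofCStarAlgebra A := by
  refine OMIN_eq_self fun n a ha => ?_
  have hquad (ω : Ω) (l : Fin n → ℂ) : 0 ≤ quad (a.map fun s => e s ω) l := by
    convert nonneg_apply_of_mem_cone e (ha l) ω using 1
    simp [quad]
  choose B hB using fun ω => exists_eq_conjTranspose_mul_self (hquad ω)
  refine ⟨Matrix.of fun i j => e.symm fun ω => B ω i j, ?_⟩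
  ext i j
  refine EquivLike.injective e (funext fun ω => ?_)
  have h := congrFun (congrFun (hB ω) i) j
  rw [Matrix.map_apply] at h
  rw [h]
  simp [Matrix.mul_apply, map_star]

theorem apply_eq_sum_single [Fintype Ω] [DecidableEq Ω] (f : A →ₗ[ℂ] ℂ) (a : A) :
    f a = ∑ ω, e a ω * f (e.symm (Pi.single ω 1)) := by
  have ha : a = ∑ ω, e a ω • e.symm (Pi.single ω 1) := EquivLike.injective e (by
    ext ω
    rw [map_sum]
    simp [Finset.sum_apply, map_smul, Pi.single_apply])
  conv_lhs => rw [ha]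
  simp

theorem stateModels_ofCStarAlgebra [Finite Ω] {V : Type*} {v : V → A} {q : Ω → V → ℝ}
    (hq : ∀ ω x, e (v x) ω = q ω x) :
    (ofCStarAlgebra A).stateModels v = convexHull ℝ (Set.range q) := by
  classical
  cases nonempty_fintype Ω
  refine Set.Subset.antisymm ?_ (convexHull_min ?_ (convex_stateModels _ v))
  · rintro p ⟨f, hf, hfp⟩
    rw [isState_ofCStarAlgebra_iff] at hf
    let c (ω : Ω) : ℂ := f (e.symm (Pi.single ω 1))
    have c_nonneg (ω : Ω) : 0 ≤ c ω := by
      convert hf.2 (e.symm (Pi.single ω 1)) using 2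
      rw [← map_star, ← map_mul, ← Pi.single_star, ← Pi.single_mul, star_one, one_mul]
    have sum_c : ∑ ω, (c ω).re = 1 := by
      have h := congrArg Complex.re (apply_eq_sum_single e f 1)
      simpa [hf.1] using h.symm
    have p_eq : p = ∑ ω, (c ω).re • q ω := by
      ext x
      have h := congrArg Complex.re (apply_eq_sum_single e f (v x))
      simpa [hfp, hq, mul_comm] using h
    rw [p_eq]
    exact (convex_convexHull ℝ _).sum_mem (fun ω _ => (Complex.nonneg_iff.1 (c_nonneg ω)).1) sum_c
      fun ω _ => subset_convexHull ℝ _ ⟨ω, rfl⟩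
  · rintro _ ⟨ω, rfl⟩
    exact ⟨_, isState_starAlgHom ((Pi.evalStarAlgHom ℂ (fun _ : Ω => ℂ) ω).comp
      (e : A →⋆ₐ[ℂ] (Ω → ℂ))), fun x => hq ω x⟩

end CStarAlgebra

end OperatorSystem

namespace ContextualityScenario

open OperatorSystem

variable {V : Type u} (G : ContextualityScenario V)

theorem mem_models_of_nonneg {p : V → ℝ} (hp : ∀ x, 0 ≤ p x)
    (hsum : ∀ e ∈ G.edges, ∑ x ∈ e, p x = 1) : p ∈ G.models := by
  refine ⟨fun x => ⟨hp x, ?_⟩, hsum⟩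
  obtain ⟨e, he, hx⟩ := G.cover x
  exact (Finset.single_le_sum (fun y _ => hp y) hx).trans_eq (hsum e he)

section GeneralModels

theorem card_edges_ne_zero : (G.edges.card : ℂ) ≠ 0 := by
  simpa using G.edges_nonempty.ne_empty

theorem span_range_delta :
    Submodule.span ℂ (Set.range fun i : (e : G.Edge) × e.Vertex => G.delta i.1 i.2) = ⊤ := by
  classical
  rw [← (Pi.basis fun e : G.Edge => Pi.basisFun ℂ e.Vertex).span_eq]
  congr 2
  ext1 i
  simp [delta, Pi.basis_apply]

theorem delta_mem_cone (e : G.Edge) (x : e.Vertex) :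
    G.delta e x ∈ (ofCStarAlgebra G.EdgeSum).toAOUSpace.cone := by
  classical
  refine mem_cone_ofCStarAlgebra_iff.2 ⟨G.delta e x, ?_⟩
  simp only [delta]
  rw [← Pi.single_star, ← Pi.single_star, star_one, ← Pi.single_mul, ← Pi.single_mul, one_mul]

theorem star_delta (e : G.Edge) (x : e.Vertex) : star (G.delta e x) = G.delta e x :=
  (ofCStarAlgebra G.EdgeSum).toAOUSpace.star_eq _ (G.delta_mem_cone e x)

theorem span_range_a : Submodule.span ℂ (Set.range G.a) = ⊤ := by
  rw [eq_top_iff,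
    ← LinearMap.range_eq_top.2 (OperatorSystem.Quot.mk_surjective (hJ := G.isKernel_nullSpace)),
    LinearMap.range_eq_map, ← span_range_delta, Submodule.map_span, Submodule.span_le]
  rintro _ ⟨_, ⟨⟨e, x⟩, rfl⟩, rfl⟩
  have hmk : OperatorSystem.Quot.mk _ G.nullSpace G.isKernel_nullSpace (G.delta e x) =
      (G.edges.card : ℂ)⁻¹ • G.a x.1 := by
    rw [G.a_eq e x, inv_smul_smul₀ G.card_edges_ne_zero]
  change OperatorSystem.Quot.mk _ _ _ (G.delta e x) ∈ _
  rw [hmk]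
  exact Submodule.smul_mem _ _ (Submodule.subset_span ⟨_, rfl⟩)

theorem isSelfAdjointSpanning_a : IsSelfAdjointSpanning G.a where
  star_eq x := by
    rw [a, star_smul, star_natCast, OperatorSystem.Quot.mk_star, star_delta]
  span_eq_top := G.span_range_a

theorem a_mem_cone (x : V) : G.a x ∈ G.S.toAOUSpace.cone := by
  rw [a, ← Complex.ofReal_natCast]
  exact G.S.toAOUSpace.smul_mem _ (Nat.cast_nonneg _) _
    (mk_mem_quotient_cone (G.delta_mem_cone _ _))

theorem sum_a {e : Finset V} (he : e ∈ G.edges) : ∑ x ∈ e, G.a x = G.S.unit := by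
  rw [← Finset.sum_coe_sort]
  simp only [G.a_eq ⟨e, he⟩]
  rw [← Finset.smul_sum, ← map_sum, ← map_smul]
  change _ = OperatorSystem.Quot.mk _ _ _ 1
  rw [← sub_eq_zero, ← map_sub, OperatorSystem.Quot.mk_eq_zero, mem_nullSpace]
  intro p hp
  have hsum : ∑ x : e, (p x : ℂ) = 1 := by
    rw [Finset.sum_coe_sort e fun x => (p x : ℂ)]
    exact_mod_cast hp.2 e he
  simp only [map_sub, map_smul, map_sum, G.pairing_one hp, pairing_delta, hsum, smul_eq_mul,
    mul_one, sub_self]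

theorem isState_smul_pairing {p : V → ℝ} (hp : p ∈ G.models) :
    (ofCStarAlgebra G.EdgeSum).IsState ((G.edges.card : ℂ)⁻¹ • G.pairing p) := by
  refine isState_ofCStarAlgebra_iff.2 ⟨?_, fun u => ?_⟩
  · rw [LinearMap.smul_apply, G.pairing_one hp, smul_eq_mul, inv_mul_cancel₀ G.card_edges_ne_zero]
  · refine mul_nonneg (inv_nonneg.2 (Nat.cast_nonneg _)) (Finset.sum_nonneg fun e _ =>
      Finset.sum_nonneg fun x _ => ?_)
    exact mul_nonneg (Complex.zero_le_real.2 (hp.1 x.1).1) (star_mul_self_nonneg (u e x))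

theorem stateModels_S : G.S.stateModels G.a = G.models := by
  refine Set.Subset.antisymm ?_ fun p hp => ?_
  · rintro p ⟨f, hf, hfp⟩
    refine G.mem_models_of_nonneg (fun x => ?_) fun e he => ?_
    · rw [← Complex.zero_le_real, ← hfp]
      exact hf.2 _ (G.a_mem_cone x)
    · have hsum := hf.1
      rw [← G.sum_a he, map_sum] at hsum
      simp only [hfp] at hsum
      exact_mod_cast hsum
  · have hker : G.nullSpace ≤ LinearMap.ker ((G.edges.card : ℂ)⁻¹ • G.pairing p) := fun u hu => by
      rw [LinearMap.mem_ker, LinearMap.smul_apply, G.mem_nullSpace.1 hu p hp, smul_zero]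
    obtain ⟨f, hf, hfp⟩ := (G.isState_smul_pairing hp).exists_quotient_lift
      (hJ := G.isKernel_nullSpace) hker
    refine ⟨f, hf, fun x => ?_⟩
    rw [a, map_smul, hfp, LinearMap.smul_apply, pairing_delta,
      smul_inv_smul₀ G.card_edges_ne_zero]

end GeneralModels

section QuantumModels

variable {G}

theorem FreeStarAlg.continuous_eval (R : G.ProjRep) : Continuous (FreeStarAlg.eval R) :=
  AddMonoidHomClass.continuous_of_bound _ 1 fun a => by
    rw [one_mul, FreeStarAlg.norm_def]
    exact FreeStarAlg.le_univNorm R a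

/-- The continuous extension to `C*(G)` of the evaluation of *-polynomials at a projective
representation. -/
noncomputable def CStar.liftAlgHom (R : G.ProjRep) : G.CStar →ₐ[ℂ] (R.H →L[ℂ] R.H) where
  __ := (UniformSpace.Completion.extensionHom (FreeStarAlg.eval R : G.FreeStarAlg →+* _)
    (FreeStarAlg.continuous_eval R) : G.CStar →+* (R.H →L[ℂ] R.H))
  commutes' z := (UniformSpace.Completion.extensionHom_coe _ _ _).trans
    ((FreeStarAlg.eval R).commutes z)

theorem CStar.liftAlgHom_ofFree (R : G.ProjRep) (a : G.FreeStarAlg) :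
    CStar.liftAlgHom R (CStar.ofFree a) = FreeStarAlg.eval R a :=
  UniformSpace.Completion.extensionHom_coe _ (FreeStarAlg.continuous_eval R) a

theorem CStar.continuous_liftAlgHom (R : G.ProjRep) : Continuous (CStar.liftAlgHom R) :=
  UniformSpace.Completion.continuous_extension

/-- The representation of `C*(G)` that a projective representation of `G` determines by the
universal property. -/
noncomputable def CStar.lift (R : G.ProjRep) : G.CStar →⋆ₐ[ℂ] (R.H →L[ℂ] R.H) where
  __ := CStar.liftAlgHom R
  map_star' a := by
    refine CStar.denseRange_ofFree.induction_on
      (p := fun a => CStar.liftAlgHom R (star a) = star (CStar.liftAlgHom R a)) a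
      (isClosed_eq ((CStar.continuous_liftAlgHom R).comp CStar.continuous_star')
        (CStar.continuous_liftAlgHom R).star) fun a => ?_
    rw [CStar.star_ofFree, CStar.liftAlgHom_ofFree, CStar.liftAlgHom_ofFree, FreeStarAlg.eval_star]

theorem CStar.lift_p (R : G.ProjRep) (x : V) : CStar.lift R (CStar.p x) = R.P x :=
  (CStar.liftAlgHom_ofFree R _).trans (FreeStarAlg.eval_gen R x)

/-- The projective representation of `G` given by the images of the canonical projections under a
representation of `C*(G)`. -/
noncomputable def ProjRep.ofStarAlgHom {H : Type u} [NormedAddCommGroup H] [InnerProductSpace ℂ H]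
    [CompleteSpace H] (π : G.CStar →⋆ₐ[ℂ] (H →L[ℂ] H)) : G.ProjRep where
  H := H
  P x := π (CStar.p x)
  proj x := (CStar.isStarProjection_p x).map π
  sum_eq e he := by rw [← map_sum, CStar.sum_p he, map_one]

variable (G)

theorem stateModels_CStar :
    (ofCStarAlgebra G.CStar).stateModels CStar.p = G.quantumModels := by
  ext p
  constructor
  · rintro ⟨f, hf, hfp⟩
    obtain ⟨H, _, _, _, π, ψ, hψ, hfπ⟩ := hf.exists_starAlgHom_eq_inner
    exact ⟨ProjRep.ofStarAlgHom π, ψ, hψ, fun x => (hfp x).symm.trans (hfπ _)⟩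
  · rintro ⟨R, ψ, hψ, hp⟩
    refine ⟨_, isState_inner_starAlgHom (CStar.lift R) hψ, fun x => ?_⟩
    change inner ℂ ψ (CStar.lift R (CStar.p x) ψ) = _
    rw [CStar.lift_p, hp]

theorem isSelfAdjointSpanning_p : IsSelfAdjointSpanning G.p :=
  SelfAdjSpan.isSelfAdjointSpanning_gen G.star_p

theorem stateModels_T : G.T.stateModels G.p = G.quantumModels :=
  (stateModels_subsystem _ _ _).trans G.stateModels_CStar

end QuantumModels

section ClassicalModels

theorem mem_zeroLocus_iff {ω : G.Selection} :
    ω ∈ G.zeroLocus ↔ ∀ (e f : G.Edge) (x : V) (he : x ∈ e.1) (hf : x ∈ f.1),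
      G.tensorDelta e ⟨x, he⟩ ω = G.tensorDelta f ⟨x, hf⟩ ω := by
  refine ⟨fun h e f x he hf => sub_eq_zero.1 (h _ (Ideal.subset_span ⟨e, f, x, he, hf, rfl⟩)),
    fun h g hg => ?_⟩
  have hle : G.tensorIdeal ≤ RingHom.ker (Pi.evalRingHom (fun _ : G.Selection => ℂ) ω) := by
    refine Ideal.span_le.2 ?_
    rintro _ ⟨e, f, x, he, hf, rfl⟩
    exact sub_eq_zero.2 (h e f x he hf)
  exact hle hg

/-- The deterministic model that assigns the value `1` to the vertices chosen by a point of the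
zero locus. -/
noncomputable def modelOf (ω : G.zeroLocus) (x : V) : ℝ := by
  classical exact if ω.1 (G.edgeOf x) = ⟨x, G.mem_edgeOf x⟩ then 1 else 0

theorem restr_d (ω : G.zeroLocus) (x : V) :
    ClassicalCStar.restr G (ClassicalCStar.d G x) ω = G.modelOf ω x := by
  rw [ClassicalCStar.d, ClassicalCStar.restr_mk]
  simp only [tensorDelta, modelOf, apply_ite Complex.ofReal, Complex.ofReal_one,
    Complex.ofReal_zero]

theorem modelOf_mem_deterministicModels (ω : G.zeroLocus) :
    G.modelOf ω ∈ G.deterministicModels := by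
  have zero_or_one (x : V) : G.modelOf ω x = 0 ∨ G.modelOf ω x = 1 := by
    rw [modelOf]
    split <;> simp
  refine ⟨G.mem_models_of_nonneg (fun x => ?_) fun e he => ?_, zero_or_one⟩
  · rcases zero_or_one x with h | h <;> simp [h]
  · have hsum := congrFun (congrArg (ClassicalCStar.restr G) (ClassicalCStar.sum_d G ⟨e, he⟩)) ω
    rw [map_sum, Finset.sum_apply, map_one, Pi.one_apply] at hsum
    simp only [restr_d] at hsum
    rw [← Finset.sum_coe_sort]
    exact_mod_cast hsum

theorem exists_selection_tensorDelta_eq {q : V → ℝ} (hq : q ∈ G.deterministicModels) :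
    ∃ ω : G.Selection, ∀ (e : G.Edge) (x : e.Vertex), G.tensorDelta e x ω = q x.1 := by
  classical
  have hex (e : G.Edge) : ∃ x : e.Vertex, q x.1 = 1 := by
    by_contra! hne
    have hsum := hq.1.2 e.1 e.2
    rw [Finset.sum_eq_zero fun x hx => (hq.2 x).resolve_right (hne ⟨x, hx⟩)] at hsum
    exact zero_ne_one hsum
  choose ω hω using hex
  refine ⟨ω, fun e x => ?_⟩
  rw [tensorDelta]
  split_ifs with hx
  · rw [← hx, hω, Complex.ofReal_one]
  · have hle : q (ω e).1 + q x.1 ≤ 1 := by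
      rw [← hq.1.2 e.1 e.2, ← Finset.sum_pair fun h => hx (Subtype.ext h)]
      refine Finset.sum_le_sum_of_subset_of_nonneg ?_ fun y _ _ => (hq.1.1 y).1
      exact Finset.insert_subset (ω e).2 (Finset.singleton_subset_iff.2 x.2)
    rw [hω, add_le_iff_nonpos_right] at hle
    rw [hle.antisymm (hq.1.1 x.1).1, Complex.ofReal_zero]

theorem range_modelOf : Set.range G.modelOf = G.deterministicModels := by
  refine Set.Subset.antisymm (Set.range_subset_iff.2 G.modelOf_mem_deterministicModels)
    fun q hq => ?_
  obtain ⟨ω, hω⟩ := G.exists_selection_tensorDelta_eq hq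
  have hmem : ω ∈ G.zeroLocus := G.mem_zeroLocus_iff.2 fun e f x he hf => by rw [hω, hω]
  refine ⟨⟨ω, hmem⟩, funext fun x => Complex.ofReal_injective ?_⟩
  rw [← restr_d, ← hω (G.edgeOf x) ⟨x, G.mem_edgeOf x⟩]
  rfl

theorem restr_surjective : Function.Surjective (ClassicalCStar.restr G) := fun g => by
  classical
  refine ⟨ClassicalCStar.mk G fun ω => if h : ω ∈ G.zeroLocus then g ⟨ω, h⟩ else 0, ?_⟩
  ext ω
  rw [ClassicalCStar.restr_mk, dif_pos ω.2]

/-- The identification of `D_G` with the algebra of functions on the zero locus. -/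
noncomputable def classicalCStarEquiv : G.ClassicalCStar ≃⋆ₐ[ℂ] (G.zeroLocus → ℂ) :=
  StarAlgEquiv.ofBijective
    ({ ClassicalCStar.restr G with map_star' := ClassicalCStar.restr_star G } :
      G.ClassicalCStar →⋆ₐ[ℂ] (G.zeroLocus → ℂ))
    ⟨ClassicalCStar.restr_injective G, G.restr_surjective⟩

theorem isSelfAdjointSpanning_d : IsSelfAdjointSpanning G.d :=
  SelfAdjSpan.isSelfAdjointSpanning_gen (ClassicalCStar.star_d G)

theorem stateModels_R : G.R.stateModels G.d = G.classicalModels := by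
  rw [classicalModels, ← range_modelOf,
    ← stateModels_ofCStarAlgebra (v := ClassicalCStar.d G) G.classicalCStarEquiv G.restr_d]
  exact stateModels_subsystem _ _ _

theorem OMIN_R : G.R.OMIN = G.R := OMIN_subsystem (OMIN_ofCStarAlgebra G.classicalCStarEquiv) _ _

end ClassicalModels

end ContextualityScenario

theorem mainTheorem11 {V : Type u} [Finite V] (G : ContextualityScenario V)
    (hG : G.models.Nonempty) :
    (G.models = G.quantumModels ↔ OperatorSystem.CanonicallyEq G.S.OMIN G.T.OMIN G.a G.p) ∧
    (G.quantumModels = G.classicalModels ↔ OperatorSystem.CanonicallyEq G.T.OMIN G.R G.p G.d) ∧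
    (G.classicalModels = G.models ↔ OperatorSystem.CanonicallyEq G.R G.S.OMIN G.d G.a) := by
  have ha := G.isSelfAdjointSpanning_a
  have hp := G.isSelfAdjointSpanning_p
  have hd := G.isSelfAdjointSpanning_d
  rw [← G.OMIN_R, OperatorSystem.canonicallyEq_OMIN_iff ha hp,
    OperatorSystem.canonicallyEq_OMIN_iff hp hd, OperatorSystem.canonicallyEq_OMIN_iff hd ha,
    G.stateModels_S, G.stateModels_T, G.stateModels_R]
  exact ⟨.rfl, .rfl, .rfl⟩
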